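/- A *folded ribbon knot* of width $w>0$ is a closed strip of paper, folded flat into the plane along $n\ge 3$ straight creases, one at each vertex of a closed oriented polygon $K$ (its centreline, a regular knot diagram). The crease at a vertex is the line through it in the direction of the sum of the unit vectors of the incoming and outgoing edges; the boundary of the ribbon is at distance $w/2$ from $K$; the creases are disjoint on the strip; and the overlapping layers are ordered consistently, so that the paper does not pass through itself. The ribbon is a Möbius band if $n$ is odd and an annulus if $n$ is even. Its *ribbonlength* (aspect ratio) is $\mathrm{Len}(K)/w$. Its *ribbon linking number* $\mathrm{Lk}$ is the linking number of $K$ with the boundary (Möbius band), respectively with one boundary component (annulus), all curves directed along $K$; crossings have their usual signs, given by the layers. A fold is an *overfold* if the outgoing part of the ribbon lies above the incoming part, otherwise an *underfold*, and it is a left or right fold according to the turn of $K$. With the usual (right-handed) sign of a crossing, the *contribution* of a fold is $+1$ for right overfolds and left underfolds, and $-1$ for left overfolds and right underfolds (the opposite crossing convention changes all these signs). **Theorem.** There are constants $C$ and $c$ such that for every $N\in\mathbb N$, every sign $s=\pm1$, and each of the two topological types (Möbius band, annulus), there is a folded ribbon knot of this type whose centreline is an unknot, whose ribbonlength is at most $C$,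 and whose ribbon linking number satisfies $s\cdot \mathrm{Lk}\ge N$. Moreover, the ribbon can be chosen such that its centreline does not cross itself and is in general position with respect to the boundary, and such that $\mathrm{Lk}$ is given by the fold-counting rule: $\mathrm{Lk}$ is the sum of the contributions of all folds for the Möbius band, and half of this sum for the annulus. Its folds consist of $k\ge 0$ consecutive *wrapping* folds, each of contribution $s$, followed by $m>0$ consecutive *accordion* folds, whose contributions alternate in sign and add up to $0$, and of at most $c$ further folds; on the strip, the crease lines of the wrapping and accordion folds are all parallel, at $45^\circ$ to the sides. -/

import Mathlib

namespace FoldedRibbon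

/-- The cross product `det (z, w)` of two vectors of the Euclidean plane `ℂ`. -/
def cross (z w : ℂ) : ℝ := z.re * w.im - z.im * w.re

/-- The Euclidean inner product of two vectors of the plane `ℂ`. -/
def dot (z w : ℂ) : ℝ := z.re * w.re + z.im * w.im

/-- The raw data of a flat folded ribbon: a closed oriented polygon with vertices
`v 0, v 1, ..., v (n - 1)` (indices mod `n`) in the plane, which is the centreline, a width, and a
relation `above` between the flat pieces of the ribbon. Piece `i` runs along the centreline edge
from `v i` to `v (i + 1)`; piece `i - 1` and piece `i` are joined by the fold at `v i`. -/
structure RibbonData where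
  n : ℕ
  v : ZMod n → ℂ
  width : ℝ
  above : ZMod n → ZMod n → Prop

namespace RibbonData

variable (R : RibbonData)

/-- The closed centreline edge from `v i` to `v (i + 1)`. -/
def edge (i : ZMod R.n) : Set ℂ := segment ℝ (R.v i) (R.v (i + 1))

/-- The unit direction vector of edge `i`. -/
noncomputable def dir (i : ZMod R.n) : ℂ :=
  ((‖R.v (i + 1) - R.v i‖⁻¹ : ℝ) : ℂ) * (R.v (i + 1) - R.v i)

/-- The sine of the angle by which the centreline turns at `v i`: positive for a left turn,
negative for a right turn. -/
noncomputable def turn (i : ZMod R.n) : ℝ := cross (R.dir (i - 1)) (R.dir i)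

/-- Half of the fold line at `v i`, as a vector. Reflection in this vector takes the incoming
direction to the outgoing direction, and its end points `v i ± foldVec i` are at distance
`width / 2` from the lines through the two edges at `v i`. The end `v i + foldVec i` lies to the
left of the incoming edge and to the right of the outgoing edge. -/
noncomputable def foldVec (i : ZMod R.n) : ℂ :=
  ((R.width / 2 / R.turn i : ℝ) : ℂ) * (R.dir (i - 1) + R.dir i)

/-- The fold line (crease) at `v i`, without its end points. -/
def crease (i : ZMod R.n) : Set ℂ := openSegment ℝ (R.v i - R.foldVec i) (R.v i + R.foldVec i)

/-- The normal of the crease at `v i` which points to the side on which both adjacent pieces lie. -/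
noncomputable def creaseNormal (i : ZMod R.n) : ℂ := R.dir i - R.dir (i - 1)

/-- The open flat piece of the ribbon along edge `i`: the points at distance less than `width / 2`
from the line through the edge, between the fold lines at `v i` and at `v (i + 1)`. -/
def piece (i : ZMod R.n) : Set ℂ :=
  {p | |cross (R.dir i) (p - R.v i)| < R.width / 2 ∧
    0 < dot (R.creaseNormal i) (p - R.v i) ∧
    0 < dot (R.creaseNormal (i + 1)) (p - R.v (i + 1))}

/-- The initial corner of piece `i` on its left side (`σ = 1`) or on its right side (`σ = -1`). -/
noncomputable def startCorner (i : ZMod R.n) (σ : ℤ) : ℂ := R.v i - (σ : ℂ) * R.foldVec i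

/-- The final corner of piece `i` on its left side (`σ = 1`) or on its right side (`σ = -1`). -/
noncomputable def endCorner (i : ZMod R.n) (σ : ℤ) : ℂ :=
  R.v (i + 1) + (σ : ℂ) * R.foldVec (i + 1)

/-- Two different pieces overlap. -/
def Overlap (i j : ZMod R.n) : Prop := i ≠ j ∧ (R.piece i ∩ R.piece j).Nonempty

/-- Piece `k` lies between pieces `i` and `j` in the layer order. -/
def Between (k i j : ZMod R.n) : Prop := Xor (R.above k i) (R.above k j)

end RibbonData

/-- A folded ribbon knot: the centreline is a regular polygonal diagram, the ribbon is folded at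
each vertex, fold lines do not meet on the strip of paper, and `above` is a consistent layering of
the folded strip which does not make the paper pass through itself. -/
structure FoldedRibbonKnot extends RibbonData where
  three_le : 3 ≤ n
  width_pos : 0 < width
  /-- There is an actual fold at each vertex. -/
  turn_ne_zero : ∀ i, toRibbonData.turn i ≠ 0
  /-- On the strip, consecutive fold lines are disjoint and come in the right order. -/
  creases_disjoint : ∀ i, ∀ σ : ℤ, (σ = 1 ∨ σ = -1) →
    0 < dot (toRibbonData.dir i) (toRibbonData.endCorner i σ - toRibbonData.startCorner i σ)
  /-- A vertex of the centreline lies on no edge except the two that it ends. -/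
  vertex_regular : ∀ i j, v i ∈ toRibbonData.edge j → i = j ∨ i = j + 1
  /-- The centreline has no triple points. -/
  no_triple : ∀ i j k, i ≠ j → j ≠ k → i ≠ k →
    toRibbonData.edge i ∩ toRibbonData.edge j ∩ toRibbonData.edge k = ∅
  /-- Of two overlapping pieces exactly one is above the other. -/
  above_irrefl : ∀ i, ¬ above i i
  above_xor : ∀ i j, toRibbonData.Overlap i j → Xor (above i j) (above j i)
  /-- Over each point of the plane the layers are linearly ordered. -/
  above_trans : ∀ i j k,
    (toRibbonData.piece i ∩ toRibbonData.piece j ∩ toRibbonData.piece k).Nonempty →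
    above i j → above j k → above i k
  /-- A piece which extends across a fold is not between the two layers joined by the fold. -/
  fold_piece : ∀ i k, k ≠ i - 1 → k ≠ i →
    (toRibbonData.crease i ∩ toRibbonData.piece k).Nonempty →
    ¬ toRibbonData.Between k (i - 1) i
  /-- Two folds that lie on top of each other and open to the same side are not interleaved: the
  layers of the one are both between, or both not between, the layers of the other. -/
  fold_fold : ∀ i j, i ≠ j →
    (toRibbonData.crease i ∩ toRibbonData.crease j).Nonempty →
    SameRay ℝ (toRibbonData.creaseNormal i) (toRibbonData.creaseNormal j) →
    (toRibbonData.Between (j - 1) (i - 1) i ↔ toRibbonData.Between j (i - 1) i)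

/-- The topological type of a ribbon. -/
inductive BandType
  | mobius
  | annulus

namespace RibbonData

variable (R : RibbonData)

/-- Each fold exchanges the left side and the right side of the ribbon (relative to its direction
in the plane), so the closed ribbon is a Möbius band if the number of folds is odd and an annulus
if it is even. -/
noncomputable def bandType : BandType :=
  open Classical in if Odd R.n then BandType.mobius else BandType.annulus

/-- The length of the centreline. -/
noncomputable def length : ℝ :=
  ∑ k ∈ Finset.range R.n, ‖R.v ((k : ZMod R.n) + 1) - R.v (k : ZMod R.n)‖

/-- The ribbonlength (aspect ratio): length divided by width. -/
noncomputable def ribbonlength : ℝ := R.length / R.width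

/-- The point of edge `i` at parameter `t`. -/
noncomputable def point (i : ZMod R.n) (t : ℝ) : ℂ := R.v i + (t : ℂ) * (R.v (i + 1) - R.v i)

/-- The heights `h i t` over the points of the edges lift the centreline to a closed curve in space
with the over- and under-crossings given by the layers of the ribbon. -/
def IsLift (h : ZMod R.n → ℝ → ℝ) : Prop :=
  (∀ i, ContinuousOn (h i) (Set.Icc 0 1)) ∧
  (∀ i, h i 1 = h (i + 1) 0) ∧
  ∀ i j, i ≠ j → ∀ s ∈ Set.Ioo (0 : ℝ) 1, ∀ t ∈ Set.Ioo (0 : ℝ) 1,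
    R.point i s = R.point j t → R.above i j → h j t < h i s

/-- The closed curve in the space `ℂ × ℝ` with heights `h`. -/
def liftedCurve (h : ZMod R.n → ℝ → ℝ) : Set (ℂ × ℝ) :=
  {q | ∃ i, ∃ t ∈ Set.Icc (0 : ℝ) 1, q = (R.point i t, h i t)}

/-- The centreline is unknotted: some homeomorphism of space takes its lift to a round circle. -/
def IsUnknot : Prop :=
  ∃ h, R.IsLift h ∧ ∃ Φ : (ℂ × ℝ) ≃ₜ (ℂ × ℝ),
    Φ '' R.liftedCurve h = {q | ‖q.1‖ = 1 ∧ q.2 = 0}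

/-- The centreline does not cross itself in the plane. -/
def NoCrossings : Prop :=
  ∀ i j, i ≠ j → i ≠ j + 1 → j ≠ i + 1 → Disjoint (R.edge i) (R.edge j)

/-- The sign of the crossing of centreline edge `i` with the side `σ` of piece `j`, both directed
along the centreline, and `0` if they do not cross. A crossing is positive if the direction of the
under-strand is obtained from that of the over-strand by a counterclockwise rotation by less than
`π`. -/
noncomputable def crossingSign (i j : ZMod R.n) (σ : ℤ) : ℤ :=
  open Classical in
  if (openSegment ℝ (R.v i) (R.v (i + 1)) ∩
      openSegment ℝ (R.startCorner j σ) (R.endCorner j σ)).Nonempty then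
    (if R.above i j then 1 else -1) * (SignType.sign (cross (R.dir i) (R.dir j)) : ℤ)
  else 0

/-- The centreline and the boundary are in general position in the plane: no vertex of one of them
lies on the other. -/
def GeneralPosition : Prop :=
  ∀ i j, ∀ σ : ℤ, (σ = 1 ∨ σ = -1) →
    R.v i ∉ segment ℝ (R.startCorner j σ) (R.endCorner j σ) ∧ R.startCorner j σ ∉ R.edge i

/-- The number of sides of the boundary component that starts on the left side of piece `0`; its
`k`-th side is the side `(-1) ^ k` of piece `k`. For a Möbius band this is the whole boundary,
which runs twice along the centreline. -/
noncomputable def boundarySides : ℕ := open Classical in if Odd R.n then 2 * R.n else R.n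

/-- The ribbon linking number: the linking number of the centreline and the boundary (for a Möbius
band) or one boundary component (for an annulus), as half of the sum of the signs of all crossings
between the two curves. -/
noncomputable def ribbonLk : ℚ :=
  (1 / 2 : ℚ) * ∑ i ∈ Finset.range R.n, ∑ k ∈ Finset.range R.boundarySides,
    (R.crossingSign (i : ZMod R.n) (k : ZMod R.n) ((-1) ^ k) : ℚ)

/-- The contribution of the fold at `v i`: `+1` for right overfolds and left underfolds, `-1` for
left overfolds and right underfolds. The fold is an overfold if the outgoing piece is above the
incoming one. -/
noncomputable def foldSign (i : ZMod R.n) : ℤ :=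
  open Classical in
  if R.above i (i - 1) then -(SignType.sign (R.turn i) : ℤ) else (SignType.sign (R.turn i) : ℤ)

/-- The sum of the contributions of all folds. -/
noncomputable def foldSum : ℤ := ∑ i ∈ Finset.range R.n, R.foldSign (i : ZMod R.n)

/-- The fold-counting rule for a ribbon whose centreline has no crossings: in a Möbius band each
fold contributes `±1`, in an annulus half as much. -/
noncomputable def foldCount : ℚ :=
  match R.bandType with
  | BandType.mobius => (R.foldSum : ℚ)
  | BandType.annulus => (R.foldSum : ℚ) / 2

/-- The fold lines of the `k` consecutive folds from number `a` on are parallel on the strip, at 45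
degrees to its sides: the centreline turns by right angles, alternately left and right. -/
def DiagonalFolds (a k : ℕ) : Prop :=
  (∀ j < k, |R.turn ((a + j : ℕ) : ZMod R.n)| = 1) ∧
  ∀ j, j + 1 < k → R.turn ((a + j + 1 : ℕ) : ZMod R.n) = -R.turn ((a + j : ℕ) : ZMod R.n)

/-- The `k` consecutive folds from number `a` on form an accordion: parallel diagonal folds, made
alternately to the one face and to the other face of the paper. -/
def IsAccordion (a k : ℕ) : Prop :=
  R.DiagonalFolds a k ∧
  ∀ j, j + 1 < k →
    R.foldSign ((a + j + 1 : ℕ) : ZMod R.n) = -R.foldSign ((a + j : ℕ) : ZMod R.n)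

/-- The `k` consecutive folds from number `a` on form a wrapping of sign `s`: parallel diagonal
folds, all made to the same face of the paper, each of contribution `s`. -/
def IsWrapping (a k : ℕ) (s : ℤ) : Prop :=
  R.DiagonalFolds a k ∧ ∀ j < k, R.foldSign ((a + j : ℕ) : ZMod R.n) = s

end RibbonData

end FoldedRibbon

/-! ### The construction: a wrapped staircase, its layers and its coordinates. -/

namespace FoldedRibbon

/-! Folds are cheap when the pieces between them are short. For odd `w`, take a ribbon of width `6 *
w` whose centreline climbs a staircase of `8 * w` steps of length 2, followed by a closing polygon
of size proportional to `w`. The ribbonlength stays bounded while the number of folds grows. All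
staircase creases lie on the lines `x - y = 0` and `x - y = 2`, so the staircase part of the ribbon
folds up into a thin diagonal stack.

In this stack the last `7 * w` short pieces form an accordion, and the first `w` pieces are wound
around it in an inward spiral, alternately above and below. Each of the first `w` folds contributes
`s`, and the accordion contributes 0. The accordion also drifts along the diagonal: the wrapping
creases stay below height `4 * w + 1`, while the outgoing strip at vertex `8 * w` stays above `5 *
w`. So the inner end leaves the wrapping through its open end, and the closing pieces pass below
everything. The sign `s` only reverses the layer order.

The layers are given by an injective integer `rank`. The folding axioms then say that the rank
intervals of folds lying over each other are nested or disjoint, and that no piece crosses a fold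
between its layers (`fold_fold_rank`, `fold_piece_rank`, `fold_piece_geometry`).

Along the staircase the boundary consists of the translates of the centreline by `±(3w, 3w)`, so its
crossings with the staircase edges pair indices that differ by `3 * w`. Counting the signs side by
side (`sideSum_same`, `sideSum_opposite`, `sideSum_first`, `sideSum_up`) gives linking number `s *
w` for the Möbius band and `s * (w + 1) / 2` for the annulus, in agreement with the fold count
(`ribbonLk_eq`).

The centreline has no crossings, so heights over it are free. Lifting the closing polygon to height
`x - y` makes room for a shear that straightens the staircase; the result is the boundary of a
planar convex polygon (`image_liftedCurve`), which a homeomorphism carries to a circle. -/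

/-- The number of folds of the ribbon `ribbon ty w s`. -/
def numFolds : BandType → ℕ → ℕ
  | .mobius, w => 8 * w + 3
  | .annulus, w => 8 * w + 4

/-- The vertices of the centreline: a staircase with `8 * w + 1` vertices, closed up by a polygon
with two or three more vertices. -/
noncomputable def vert (ty : BandType) (w k : ℕ) : ℂ :=
  if k ≤ 8 * w then ⟨k + (k % 2 : ℕ), k - (k % 2 : ℕ)⟩
  else if k = 8 * w + 1 then ⟨32 * w, 8 * w⟩
  -- The index `numFolds ty w` repeats vertex 0, so that the last edge needs no special case; the
  -- final branch concerns only vertex `8 * w + 2` of the annulus.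
  else if k = numFolds ty w then ⟨0, 0⟩
  else if k + 1 = numFolds ty w then ⟨0, -16 * w⟩
  else ⟨32 * w, -16 * w⟩

/-- The height of piece `k` in the layer order. -/
def rank (ty : BandType) (w k : ℕ) : ℤ :=
  -- Three bands: the wrapping spirals inwards from both extremes, the accordion descends in the
  -- middle, and the closing pieces have rank at most 0.
  if k < w then (if k % 2 = 0 then 20 * w - k else k)
  else if k ≤ 8 * w then 18 * w - k
  else k + 1 - numFolds ty w

/-- A staircase that is wrapped `w` times around an accordion, and then closed up. -/
noncomputable def ribbon (ty : BandType) (w : ℕ) (s : ℤ) : RibbonData where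
  n := numFolds ty w
  v i := vert ty w (ZMod.val i)
  width := 6 * w
  above i j := s * rank ty w (ZMod.val j) < s * rank ty w (ZMod.val i)

/-- Coordinates at an edge of the centreline: its initial vertex `(x, y)`, the directions `(px, py)`
of the preceding edge and `(dx, dy)` of the edge, its length, and the fold vectors `(fx, fy)` at its
initial and `(gx, gy)` at its final vertex. -/
structure Frame where
  x : ℝ
  y : ℝ
  px : ℝ
  py : ℝ
  dx : ℝ
  dy : ℝ
  len : ℝ
  fx : ℝ
  fy : ℝ
  gx : ℝ
  gy : ℝ

/-- The coordinates at edge `k` of `ribbon ty w s`. -/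
inductive Row (ty : BandType) (w : ℕ) : ℕ → Frame → Prop
  | even (a : ℕ) (h : a < 4 * w) :
      Row ty w (2 * a) ⟨2 * a, 2 * a, 0, 1, 1, 0, 2, -3 * w, -3 * w, 3 * w, 3 * w⟩
  | odd (a : ℕ) (h : a < 4 * w) :
      Row ty w (2 * a + 1) ⟨2 * a + 2, 2 * a, 1, 0, 0, 1, 2, 3 * w, 3 * w, -3 * w, -3 * w⟩
  -- The two types differ here only in the next fold vector; the bounds on `α` (and on `β` below)
  -- often allow one linear argument for both.
  | top (α : ℝ) (h₁ : 1 ≤ α) (h₂ : α ≤ 3) (hm : ty = .mobius → α = 1)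
      (ha : ty = .annulus → α = 3) :
      Row ty w (8 * w) ⟨8 * w, 8 * w, 0, 1, 1, 0, 24 * w, -3 * w, -3 * w, -α * w, 3 * w⟩
  -- A 3-4-5 triangle keeps the unit direction and the fold vectors rational.
  | slanted (h : ty = .mobius) :
      Row ty w (8 * w + 1)
        ⟨32 * w, 8 * w, 1, 0, -4 / 5, -3 / 5, 40 * w, -w, 3 * w, 3 * w, -3 / 2 * w⟩
  | down (h : ty = .annulus) :
      Row ty w (8 * w + 1) ⟨32 * w, 8 * w, 1, 0, 0, -1, 24 * w, -3 * w, 3 * w, 3 * w, 3 * w⟩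
  | left (h : ty = .annulus) :
      Row ty w (8 * w + 2)
        ⟨32 * w, -16 * w, 0, -1, -1, 0, 32 * w, 3 * w, 3 * w, 3 * w, -3 * w⟩
  | up (k : ℕ) (h : k + 1 = numFolds ty w) (p q β : ℝ) (h₁ : 3 / 2 ≤ β) (h₂ : β ≤ 3)
      (hm : ty = .mobius → p = -4 / 5 ∧ q = -3 / 5 ∧ β = 3 / 2)
      (ha : ty = .annulus → p = -1 ∧ q = 0 ∧ β = 3) :
      Row ty w k ⟨0, -16 * w, p, q, 0, 1, 16 * w, 3 * w, -β * w, -3 * w, -3 * w⟩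

theorem numFolds_bounds (ty : BandType) (w : ℕ) :
    8 * w + 3 ≤ numFolds ty w ∧ numFolds ty w ≤ 8 * w + 4 := by
  cases ty <;> simp [numFolds]

theorem exists_row (ty : BandType) {w k : ℕ} (hk : k < numFolds ty w) : ∃ f, Row ty w k f := by
  rcases lt_trichotomy k (8 * w) with h | rfl | h
  · rcases Nat.even_or_odd' k with ⟨a, rfl | rfl⟩
    · exact ⟨_, .even a (by omega)⟩
    · exact ⟨_, .odd a (by omega)⟩
  · cases ty
    · exact ⟨_, .top 1 (by norm_num) (by norm_num) (by simp) (by simp)⟩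
    · exact ⟨_, .top 3 (by norm_num) (by norm_num) (by simp) (by simp)⟩
  · cases ty <;> simp only [numFolds] at hk
    · obtain rfl | rfl : k = 8 * w + 1 ∨ k = 8 * w + 2 := by omega
      · exact ⟨_, .slanted rfl⟩
      · exact ⟨_, .up _ rfl (-4 / 5) (-3 / 5) (3 / 2) (by norm_num) (by norm_num) (by simp)
          (by simp)⟩
    · obtain rfl | rfl | rfl : k = 8 * w + 1 ∨ k = 8 * w + 2 ∨ k = 8 * w + 3 := by omega
      · exact ⟨_, .down rfl⟩
      · exact ⟨_, .left rfl⟩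
      · exact ⟨_, .up _ rfl (-1) 0 3 (by norm_num) (by norm_num) (by simp) (by simp)⟩

theorem vert_even (ty : BandType) {w a : ℕ} (h : a ≤ 4 * w) :
    vert ty w (2 * a) = ⟨2 * a, 2 * a⟩ := by
  simp [vert, show 2 * a ≤ 8 * w by omega]

theorem vert_odd (ty : BandType) {w a : ℕ} (h : a < 4 * w) :
    vert ty w (2 * a + 1) = ⟨2 * a + 2, 2 * a⟩ := by
  have : (2 * a + 1) % 2 = 1 := by omega
  simp only [vert, show 2 * a + 1 ≤ 8 * w by omega, if_true, this]
  push_cast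
  congr 1 <;> ring

theorem vert_top (ty : BandType) (w : ℕ) : vert ty w (8 * w) = ⟨8 * w, 8 * w⟩ := by
  have := vert_even ty (w := w) (a := 4 * w) le_rfl
  rw [show 2 * (4 * w) = 8 * w by ring] at this
  rw [this]
  push_cast
  congr 1 <;> ring

theorem vert_first (ty : BandType) (w : ℕ) : vert ty w (8 * w + 1) = ⟨32 * w, 8 * w⟩ := by
  simp [vert]

theorem vert_last (ty : BandType) {w k : ℕ} (h : k + 1 = numFolds ty w) :
    vert ty w k = ⟨0, -16 * w⟩ := by
  have := numFolds_bounds ty w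
  rw [vert, if_neg (by omega), if_neg (by omega), if_neg (by omega), if_pos h]

theorem vert_numFolds (ty : BandType) (w : ℕ) : vert ty w (numFolds ty w) = ⟨0, 0⟩ := by
  have := numFolds_bounds ty w
  rw [vert, if_neg (by omega), if_neg (by omega), if_pos rfl]

theorem vert_zero (ty : BandType) (w : ℕ) : vert ty w 0 = ⟨0, 0⟩ := by
  simp [vert]

theorem vert_left (w : ℕ) : vert .annulus w (8 * w + 2) = ⟨32 * w, -16 * w⟩ := by
  simp [vert, numFolds]

namespace Row

variable {ty : BandType} {w k : ℕ} {f : Frame}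

theorem lt (h : Row ty w k f) : k < numFolds ty w := by
  have := numFolds_bounds ty w
  cases h with
  | left h => subst h; simp [numFolds]
  | _ => omega

theorem vert_eq (h : Row ty w k f) : vert ty w k = ⟨f.x, f.y⟩ := by
  cases h with
  | even a h => exact vert_even ty h.le
  | odd a h => exact vert_odd ty h
  | top => exact vert_top ty w
  | slanted => exact vert_first ty w
  | down => exact vert_first ty w
  | left h => subst h; exact vert_left w
  | up k h => exact vert_last ty h

theorem vert_succ (h : Row ty w k f) :
    vert ty w (k + 1) = ⟨f.x + f.len * f.dx, f.y + f.len * f.dy⟩ := by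
  cases h with
  | even a h => rw [vert_odd ty h]; dsimp only; congr 1 <;> ring
  | odd a h =>
    rw [show 2 * a + 1 + 1 = 2 * (a + 1) by ring, vert_even ty h]
    push_cast
    congr 1 <;> ring
  | top => rw [vert_first]; dsimp only; congr 1 <;> ring
  | slanted h =>
    rw [vert_last ty (by simp [h, numFolds])]; dsimp only; congr 1 <;> ring
  | down h => subst h; rw [vert_left]; dsimp only; congr 1 <;> ring
  | left h => rw [vert_last ty (by simp [h, numFolds])]; dsimp only; congr 1 <;> ring
  | up k h => rw [h, vert_numFolds]; dsimp only; congr 1 <;> ring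

theorem dir_sq (h : Row ty w k f) : f.dx ^ 2 + f.dy ^ 2 = 1 := by
  cases h <;> norm_num

theorem len_pos (h : Row ty w k f) (hw : 0 < w) : 0 < f.len := by
  have : (0 : ℝ) < w := by exact_mod_cast hw
  cases h <;> dsimp only <;> linarith

end Row

section

variable {ty : BandType} {w k : ℕ} {s : ℤ} {f : Frame}

instance : NeZero (ribbon ty w s).n := ⟨by
  have := numFolds_bounds ty w
  change numFolds ty w ≠ 0
  omega⟩

theorem ribbon_n : (ribbon ty w s).n = numFolds ty w := rfl

theorem exists_eq_cast (i : ZMod (ribbon ty w s).n) :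
    ∃ k f, Row ty w k f ∧ i = (k : ZMod (ribbon ty w s).n) := by
  obtain ⟨f, hf⟩ := exists_row ty (ZMod.val_lt i)
  exact ⟨i.val, f, hf, (ZMod.natCast_zmod_val i).symm⟩

theorem val_cast (hk : k < numFolds ty w) : ZMod.val (k : ZMod (ribbon ty w s).n) = k :=
  ZMod.val_cast_of_lt hk

theorem cast_last (h : k + 1 = numFolds ty w) : (k : ZMod (ribbon ty w s).n) + 1 = 0 := by
  have : ((k + 1 : ℕ) : ZMod (ribbon ty w s).n) = 0 := by
    rw [h]; exact ZMod.natCast_self _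
  exact_mod_cast this

theorem ribbon_v (hk : k ≤ numFolds ty w) :
    (ribbon ty w s).v (k : ZMod (ribbon ty w s).n) = vert ty w k := by
  rcases hk.lt_or_eq with h | rfl
  · exact congrArg (vert ty w) (val_cast h)
  · have : ((numFolds ty w : ℕ) : ZMod (ribbon ty w s).n) = 0 := ZMod.natCast_self _
    rw [this, vert_numFolds, ← vert_zero ty w]
    exact congrArg (vert ty w) ZMod.val_zero

namespace Row

theorem v_eq (h : Row ty w k f) : (ribbon ty w s).v (k : ZMod (ribbon ty w s).n) = ⟨f.x, f.y⟩ := by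
  rw [ribbon_v h.lt.le, h.vert_eq]

theorem v_succ (h : Row ty w k f) :
    (ribbon ty w s).v ((k : ZMod (ribbon ty w s).n) + 1) =
      ⟨f.x + f.len * f.dx, f.y + f.len * f.dy⟩ := by
  rw [← h.vert_succ, ← ribbon_v (s := s) h.lt]
  push_cast
  rfl

theorem dir_eq (h : Row ty w k f) (hw : 0 < w) :
    (ribbon ty w s).dir (k : ZMod (ribbon ty w s).n) = ⟨f.dx, f.dy⟩ := by
  have hl := h.len_pos hw
  have hd := h.dir_sq
  have e : (ribbon ty w s).v ((k : ZMod (ribbon ty w s).n) + 1) -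
      (ribbon ty w s).v (k : ZMod (ribbon ty w s).n) = (f.len : ℂ) * ⟨f.dx, f.dy⟩ := by
    rw [h.v_succ, h.v_eq]
    apply Complex.ext <;> simp
  have n1 : ‖(⟨f.dx, f.dy⟩ : ℂ)‖ = 1 := by
    rw [Complex.norm_eq_sqrt_sq_add_sq, hd, Real.sqrt_one]
  rw [RibbonData.dir, e, norm_mul, n1, mul_one, Complex.norm_real, Real.norm_of_nonneg hl.le,
    ← mul_assoc, ← Complex.ofReal_mul, inv_mul_cancel₀ hl.ne', Complex.ofReal_one, one_mul]

/-- This confirms that the table of rows is consistent: the stored incoming direction is the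
direction of the previous row. Only row 0 goes around the cycle, to the last edge. -/
theorem dir_pred (h : Row ty w k f) (hw : 0 < w) :
    (ribbon ty w s).dir ((k : ZMod (ribbon ty w s).n) - 1) = ⟨f.px, f.py⟩ := by
  have key : ∀ {l : ℕ} {g : Frame}, Row ty w l g → l + 1 = k →
      (ribbon ty w s).dir ((k : ZMod (ribbon ty w s).n) - 1) = ⟨g.dx, g.dy⟩ := by
    rintro l g hl rfl
    rw [← hl.dir_eq (s := s) hw]
    push_cast
    simp
  have hn := numFolds_bounds ty w
  cases h with
  | even a h =>
    rcases a with _ | a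
    · obtain ⟨l, hl⟩ : ∃ l, l + 1 = numFolds ty w := ⟨numFolds ty w - 1, by omega⟩
      obtain ⟨g, hg⟩ := exists_row ty (w := w) (k := l) (by omega)
      have : (ribbon ty w s).dir (l : ZMod (ribbon ty w s).n) = ⟨0, 1⟩ := by
        rw [hg.dir_eq hw]
        cases hg with
        | left h => subst h; simp [numFolds] at hl
        | up => rfl
        | _ => omega
      rw [← this]
      congr 1
      have := cast_last (s := s) hl
      push_cast
      linear_combination -this
    · exact key (.odd a (by omega)) (by ring)
  | odd a h => exact key (.even a h) rfl
  | top =>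
    exact key (.odd (4 * w - 1) (by omega)) (by omega)
  | slanted h =>
    subst h
    exact key (.top 1 (by norm_num) (by norm_num) (by simp) (by simp)) rfl
  | down h =>
    subst h
    exact key (.top 3 (by norm_num) (by norm_num) (by simp) (by simp)) rfl
  | left h => exact key (.down h) rfl
  | up k h p q β h₁ h₂ hm ha =>
    cases ty with
    | mobius =>
      obtain ⟨rfl, rfl, -⟩ := hm rfl
      exact key (.slanted rfl) (by simp only [numFolds] at h; omega)
    | annulus =>
      obtain ⟨rfl, rfl, -⟩ := ha rfl
      exact key (.left rfl) (by simp only [numFolds] at h; omega)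

theorem turn_eq (h : Row ty w k f) (hw : 0 < w) :
    (ribbon ty w s).turn (k : ZMod (ribbon ty w s).n) = f.px * f.dy - f.py * f.dx := by
  rw [RibbonData.turn, h.dir_eq hw, h.dir_pred hw, cross]

theorem foldVec_eq (h : Row ty w k f) (hw : 0 < w) :
    (ribbon ty w s).foldVec (k : ZMod (ribbon ty w s).n) = ⟨f.fx, f.fy⟩ := by
  rw [RibbonData.foldVec, h.turn_eq hw, h.dir_eq hw, h.dir_pred hw,
    show (ribbon ty w s).width = 6 * w from rfl]
  have key : ∀ r a b c d : ℝ, (r : ℂ) * ((⟨a, b⟩ : ℂ) + ⟨c, d⟩) = ⟨r * (a + c), r * (b + d)⟩ :=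
    fun r a b c d => by apply Complex.ext <;> simp
  rw [key]
  cases h with
  | up k h p q β h₁ h₂ hm ha =>
    cases ty with
    | mobius =>
      obtain ⟨rfl, rfl, rfl⟩ := hm rfl
      dsimp only; congr 1 <;> ring
    | annulus =>
      obtain ⟨rfl, rfl, rfl⟩ := ha rfl
      dsimp only; congr 1 <;> ring
  | _ => dsimp only; congr 1 <;> ring

theorem foldVec_succ (h : Row ty w k f) (hw : 0 < w) :
    (ribbon ty w s).foldVec ((k : ZMod (ribbon ty w s).n) + 1) = ⟨f.gx, f.gy⟩ := by
  have key : ∀ {l : ℕ} {g : Frame}, Row ty w l g → l = k + 1 →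
      (ribbon ty w s).foldVec ((k : ZMod (ribbon ty w s).n) + 1) = ⟨g.fx, g.fy⟩ := by
    rintro l g hl rfl
    rw [← hl.foldVec_eq (s := s) hw]
    push_cast
    rfl
  have hn := numFolds_bounds ty w
  cases h with
  | even a h => exact key (.odd a h) rfl
  | odd a h =>
    obtain ⟨g, hg⟩ := exists_row ty (w := w) (k := 2 * a + 1 + 1) (by omega)
    rw [key hg rfl]
    generalize hl : 2 * a + 1 + 1 = l at hg
    cases hg <;> first | rfl | omega
  | top α h₁ h₂ hm ha =>
    cases ty with
    | mobius => rw [key (.slanted rfl) rfl, hm rfl]; simp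
    | annulus => rw [key (.down rfl) rfl, ha rfl]
  | slanted h =>
    subst h
    rw [key (.up (8 * w + 2) rfl (-4 / 5) (-3 / 5) (3 / 2) (by norm_num) (by norm_num) (by simp)
      (by simp)) rfl]
    congr 1
    dsimp only
    ring
  | down h => exact key (.left h) rfl
  | left h =>
    subst h
    exact key (.up (8 * w + 3) rfl (-1) 0 3 (by norm_num) (by norm_num) (by simp) (by simp)) rfl
  | up k h =>
    rw [cast_last h, ← Nat.cast_zero, (Row.even (ty := ty) 0 (by omega)).foldVec_eq hw]

end Row

end

end FoldedRibbon

/-! ### Linear descriptions of edges, creases and pieces. -/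

namespace FoldedRibbon

/-- Parametrising by `t` in `[0, l]` instead of `[0, 1]` keeps the equations linear even when the
length depends on `w`. -/
theorem mem_segment_iff {x y dx dy l : ℝ} (hl : 0 < l) {p : ℂ} :
    p ∈ segment ℝ (⟨x, y⟩ : ℂ) ⟨x + l * dx, y + l * dy⟩ ↔
      ∃ t, 0 ≤ t ∧ t ≤ l ∧ p.re = x + t * dx ∧ p.im = y + t * dy := by
  rw [segment_eq_image']
  constructor
  · rintro ⟨θ, ⟨h0, h1⟩, rfl⟩
    exact ⟨θ * l, by positivity, by nlinarith, by simp; ring, by simp; ring⟩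
  · rintro ⟨t, h0, h1, hx, hy⟩
    refine ⟨t / l, ⟨by positivity, (div_le_one hl).2 h1⟩, ?_⟩
    apply Complex.ext
    · simp [hx]; field_simp
    · simp [hy]; field_simp

theorem mem_openSegment_iff {x y dx dy l : ℝ} (hl : 0 < l) {p : ℂ} :
    p ∈ openSegment ℝ (⟨x, y⟩ : ℂ) ⟨x + l * dx, y + l * dy⟩ ↔
      ∃ t, 0 < t ∧ t < l ∧ p.re = x + t * dx ∧ p.im = y + t * dy := by
  rw [openSegment_eq_image']
  constructor
  · rintro ⟨θ, ⟨h0, h1⟩, rfl⟩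
    exact ⟨θ * l, by positivity, by nlinarith, by simp; ring, by simp; ring⟩
  · rintro ⟨t, h0, h1, hx, hy⟩
    refine ⟨t / l, ⟨by positivity, (div_lt_one hl).2 h1⟩, ?_⟩
    apply Complex.ext
    · simp [hx]; field_simp
    · simp [hy]; field_simp

namespace Row

variable {ty : BandType} {w i j k : ℕ} {s : ℤ} {f g : Frame} {p : ℂ}

theorem mem_edge (h : Row ty w k f) (hw : 0 < w) :
    p ∈ (ribbon ty w s).edge (k : ZMod (ribbon ty w s).n) ↔
      ∃ t, 0 ≤ t ∧ t ≤ f.len ∧ p.re = f.x + t * f.dx ∧ p.im = f.y + t * f.dy := by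
  rw [RibbonData.edge, h.v_eq, h.v_succ, mem_segment_iff (h.len_pos hw)]

theorem mem_crease (h : Row ty w k f) (hw : 0 < w)
    (hp : p ∈ (ribbon ty w s).crease (k : ZMod (ribbon ty w s).n)) :
    ∃ t, -1 < t ∧ t < 1 ∧ p.re = f.x + t * f.fx ∧ p.im = f.y + t * f.fy := by
  rw [RibbonData.crease, h.v_eq, h.foldVec_eq hw, openSegment_eq_image'] at hp
  obtain ⟨θ, ⟨h0, h1⟩, rfl⟩ := hp
  exact ⟨2 * θ - 1, by linarith, by linarith, by simp; ring, by simp; ring⟩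

theorem mem_piece (h : Row ty w k f) (hw : 0 < w)
    (hp : p ∈ (ribbon ty w s).piece (k : ZMod (ribbon ty w s).n)) :
    |f.dx * (p.im - f.y) - f.dy * (p.re - f.x)| < 3 * w ∧
      0 < (f.dx - f.px) * (p.re - f.x) + (f.dy - f.py) * (p.im - f.y) := by
  obtain ⟨h1, h2, -⟩ := hp
  rw [h.v_eq, h.dir_eq hw, show (ribbon ty w s).width = 6 * w from rfl] at h1
  rw [RibbonData.creaseNormal, h.v_eq, h.dir_eq hw, h.dir_pred hw] at h2
  simp only [cross, dot, Complex.sub_re, Complex.sub_im] at h1 h2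
  exact ⟨by linarith, h2⟩

theorem mem_piece_succ (h' : Row ty w (k + 1) g) (hw : 0 < w)
    (hp : p ∈ (ribbon ty w s).piece (k : ZMod (ribbon ty w s).n)) :
    0 < (g.dx - g.px) * (p.re - g.x) + (g.dy - g.py) * (p.im - g.y) := by
  obtain ⟨-, -, h3⟩ := hp
  have e : (k : ZMod (ribbon ty w s).n) + 1 = ((k + 1 : ℕ) : ZMod (ribbon ty w s).n) := by
    push_cast; rfl
  rw [RibbonData.creaseNormal, e, h'.v_eq, h'.dir_eq hw, h'.dir_pred hw] at h3
  simpa only [cross, dot, Complex.sub_re, Complex.sub_im] using h3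

/-- A piece of the staircase lies between the two lines that carry the creases of the staircase. -/
theorem mem_piece_stair (h : Row ty w k f) (hk : k < 8 * w)
    (hp : p ∈ (ribbon ty w s).piece (k : ZMod (ribbon ty w s).n)) :
    0 < p.re - p.im ∧ p.re - p.im < 2 ∧ p.im < k + 3 * w + 3 ∧ k - 3 * w - 3 < p.im := by
  have hw : 0 < w := by omega
  obtain ⟨g, hg⟩ := exists_row ty (w := w) (k := k + 1)
    (by have := numFolds_bounds ty w; omega)
  have h2 := mem_piece_succ hg hw hp
  obtain ⟨h1, h3⟩ := mem_piece h hw hp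
  rw [abs_lt] at h1
  cases h with
  | even a h =>
    generalize hl : 2 * a + 1 = l at hg
    cases hg with
    | odd b h =>
      obtain rfl : a = b := by omega
      push_cast at *
      refine ⟨?_, ?_, ?_, ?_⟩ <;> linarith
    | up => have := numFolds_bounds ty w; omega
    | _ => omega
  | odd a h =>
    generalize hl : 2 * a + 1 + 1 = l at hg
    cases hg with
    | even b h =>
      obtain rfl : b = a + 1 := by omega
      push_cast at *
      refine ⟨?_, ?_, ?_, ?_⟩ <;> linarith
    | top =>
      have : (a : ℝ) = 4 * w - 1 := by
        rw [eq_sub_iff_add_eq]; exact_mod_cast (by omega : a + 1 = 4 * w)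
      push_cast at *
      refine ⟨?_, ?_, ?_, ?_⟩ <;> linarith
    | up => have := numFolds_bounds ty w; omega
    | _ => omega
  | up => have := numFolds_bounds ty w; omega
  | _ => omega

/-- Two consecutive edges meet only in their common vertex. -/
theorem consecutive_edges (hi : Row ty w k f) (hj : Row ty w (k + 1) g) (hw : 0 < w) {a b : ℝ}
    (ha : a ≤ f.len) (hb0 : 0 ≤ b) (hb : b ≤ g.len)
    (hx : f.x + a * f.dx = g.x + b * g.dx) (hy : f.y + a * f.dy = g.y + b * g.dy) :
    a = f.len ∧ b = 0 := by
  have hw' : (0 : ℝ) < w := by exact_mod_cast hw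
  have hn := numFolds_bounds ty w
  have hv := hi.vert_succ
  rw [hj.vert_eq, Complex.ext_iff] at hv
  obtain ⟨vx, vy⟩ := hv
  dsimp only at vx vy
  generalize hl : k + 1 = l at hj
  have ht : ty = .mobius ∨ ty = .annulus := by cases ty <;> simp
  cases hi <;> cases hj <;> dsimp only at * <;>
    first
    | omega
    | (constructor <;> linarith)

/-- The staircase is monotone, and the closing edges leave it at its top and return to it from
below. The first and the last edge are excluded, since they share vertex 0. -/
theorem distant_edges (hi : Row ty w i f) (hj : Row ty w j g) (hw : 0 < w) (hij : i + 2 ≤ j)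
    (hne : i = 0 → j + 1 ≠ numFolds ty w) {a b : ℝ}
    (ha0 : 0 ≤ a) (ha : a ≤ f.len) (hb0 : 0 ≤ b) (hb : b ≤ g.len)
    (hx : f.x + a * f.dx = g.x + b * g.dx) (hy : f.y + a * f.dy = g.y + b * g.dy) : False := by
  have hw' : (0 : ℝ) < w := by exact_mod_cast hw
  have hn := numFolds_bounds ty w
  have hij' : (i : ℝ) + 2 ≤ j := by exact_mod_cast hij
  cases hi with
  | slanted h =>
    subst h
    have := hj.lt
    simp only [numFolds] at this
    omega
  | even c h =>
    cases hj with
    | up j h' =>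
      have hc : (1 : ℝ) ≤ c := by
        exact_mod_cast Nat.one_le_iff_ne_zero.2 fun h0 => hne (by omega) h'
      push_cast at *
      linarith
    | _ => push_cast at *; first | omega | linarith
  | _ => cases hj <;> push_cast at * <;> first | omega | linarith

end Row
end FoldedRibbon

/-! ### Intersections of edges and creases, and the combinatorics of the layer order. -/

namespace FoldedRibbon

namespace Row

variable {ty : BandType} {w i j k : ℕ} {s : ℤ} {f g : Frame} {p : ℂ}

theorem closing_edges (hi : Row ty w 0 f) (hj : Row ty w j g) (hw : 0 < w)
    (hn : j + 1 = numFolds ty w) {a b : ℝ} (ha0 : 0 ≤ a) (hb : b ≤ g.len)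
    (hx : f.x + a * f.dx = g.x + b * g.dx) (hy : f.y + a * f.dy = g.y + b * g.dy) :
    a = 0 ∧ b = g.len := by
  have hw' : (0 : ℝ) < w := by exact_mod_cast hw
  have hb' := numFolds_bounds ty w
  generalize hl : 0 = l at hi
  cases hi with
  | even c h =>
    obtain rfl : c = 0 := by omega
    cases hj with
    | up => push_cast at *; constructor <;> linarith
    | left h => subst h; simp [numFolds] at hn
    | _ => omega
  | _ => omega

theorem edges_meet (hi : Row ty w i f) (hj : Row ty w j g) (hw : 0 < w) (hij : i < j) {a b : ℝ}
    (ha0 : 0 ≤ a) (ha : a ≤ f.len) (hb0 : 0 ≤ b) (hb : b ≤ g.len)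
    (hx : f.x + a * f.dx = g.x + b * g.dx) (hy : f.y + a * f.dy = g.y + b * g.dy) :
    (j = i + 1 ∧ a = f.len ∧ b = 0) ∨ (i = 0 ∧ j + 1 = numFolds ty w ∧ a = 0 ∧ b = g.len) := by
  rcases (Nat.succ_le_of_lt hij).eq_or_lt with rfl | h
  · exact .inl ⟨rfl, consecutive_edges hi hj hw ha hb0 hb hx hy⟩
  · refine .inr ?_
    by_cases hc : i = 0 ∧ j + 1 = numFolds ty w
    · obtain ⟨rfl, hn⟩ := hc
      exact ⟨rfl, hn, closing_edges hi hj hw hn ha0 hb hx hy⟩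
    · exact (distant_edges hi hj hw h (fun h0 h1 => hc ⟨h0, h1⟩) ha0 ha hb0 hb hx hy).elim

theorem adjacent_of_mem_edges (hi : Row ty w i f) (hj : Row ty w j g) (hw : 0 < w) (hij : i ≠ j)
    (h₁ : p ∈ (ribbon ty w s).edge (i : ZMod (ribbon ty w s).n))
    (h₂ : p ∈ (ribbon ty w s).edge (j : ZMod (ribbon ty w s).n)) :
    j = i + 1 ∨ i = j + 1 ∨ (i = 0 ∧ j + 1 = numFolds ty w) ∨
      (j = 0 ∧ i + 1 = numFolds ty w) := by
  obtain ⟨a, a0, a1, ax, ay⟩ := (hi.mem_edge hw).1 h₁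
  obtain ⟨b, b0, b1, bx, bY⟩ := (hj.mem_edge hw).1 h₂
  rcases hij.lt_or_gt with h | h
  · have := edges_meet hi hj hw h a0 a1 b0 b1 (by linarith) (by linarith)
    tauto
  · have := edges_meet hj hi hw h b0 b1 a0 a1 (by linarith) (by linarith)
    tauto

/-- Every staircase crease is parallel to the diagonal, so the parity of the vertex decides which of
two parallel lines carries it. Creases that meet therefore have the same parity. -/
theorem mem_crease_stair (h : Row ty w k f) (hw : 0 < w) (hk : k ≤ 8 * w)
    (hp : p ∈ (ribbon ty w s).crease (k : ZMod (ribbon ty w s).n)) :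
    p.re - p.im = 2 * (k % 2 : ℕ) ∧ k - 3 * w - 1 < p.im ∧ p.im < k + 3 * w + 1 := by
  have hw' : (0 : ℝ) < w := by exact_mod_cast hw
  obtain ⟨t, h0, h1, hx, hy⟩ := h.mem_crease hw hp
  have hb := numFolds_bounds ty w
  have h2 := mul_lt_mul_of_pos_right h0 hw'
  have h3 := mul_lt_mul_of_pos_right h1 hw'
  cases h with
  | even a h =>
    rw [show 2 * a % 2 = 0 by omega]
    push_cast
    refine ⟨?_, ?_, ?_⟩ <;> linarith
  | odd a h =>
    rw [show (2 * a + 1) % 2 = 1 by omega]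
    push_cast
    refine ⟨?_, ?_, ?_⟩ <;> linarith
  | top =>
    rw [show 8 * w % 2 = 0 by omega]
    push_cast
    refine ⟨?_, ?_, ?_⟩ <;> linarith
  | _ => omega

/-- This coarse bound suffices away from the staircase, where the vertices are much further than `6
* w` from all others. -/
theorem mem_crease_box (h : Row ty w k f) (hw : 0 < w)
    (hp : p ∈ (ribbon ty w s).crease (k : ZMod (ribbon ty w s).n)) :
    |p.re - f.x| < 3 * w ∧ |p.im - f.y| < 3 * w := by
  have hw' : (0 : ℝ) < w := by exact_mod_cast hw
  obtain ⟨t, h0, h1, hx, hy⟩ := h.mem_crease hw hp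
  have ht : |t| < 1 := abs_lt.2 ⟨h0, h1⟩
  have hf : |f.fx| ≤ 3 * w ∧ |f.fy| ≤ 3 * w := by
    cases h with
    | up => dsimp only; constructor <;> rw [abs_le] <;> constructor <;> nlinarith
    | _ => dsimp only; constructor <;> rw [abs_le] <;> constructor <;> linarith
  rw [hx, hy, add_sub_cancel_left, add_sub_cancel_left, abs_mul, abs_mul]
  constructor <;> nlinarith [abs_nonneg t, abs_nonneg f.fx, abs_nonneg f.fy]

theorem crease_disjoint_of_far (hi : Row ty w i f) (hj : Row ty w j g) (hw : 0 < w) (hij : i ≠ j)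
    (hfar : 8 * w < i) (h₁ : p ∈ (ribbon ty w s).crease (i : ZMod (ribbon ty w s).n))
    (h₂ : p ∈ (ribbon ty w s).crease (j : ZMod (ribbon ty w s).n)) : False := by
  have hw' : (1 : ℝ) ≤ w := by exact_mod_cast hw
  have ha : ∀ {a : ℕ}, a < 4 * w → (a : ℝ) + 1 ≤ 4 * w := fun h => by exact_mod_cast h
  obtain ⟨b₁, b₂⟩ := hi.mem_crease_box hw h₁
  obtain ⟨c₁, c₂⟩ := hj.mem_crease_box hw h₂
  rw [abs_lt] at b₁ b₂ c₁ c₂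
  cases hi with
  | even => omega
  | odd => omega
  | top => omega
  | _ =>
    cases hj with
    | even a h => have := ha h; have : (0 : ℝ) ≤ a := a.cast_nonneg; linarith
    | odd a h => have := ha h; have : (0 : ℝ) ≤ a := a.cast_nonneg; linarith
    | _ => first | omega | linarith

theorem turn_ne_zero (h : Row ty w k f) : f.px * f.dy - f.py * f.dx ≠ 0 := by
  cases h with
  | up k h p q β h₁ h₂ hm ha =>
    cases ty with
    | mobius => obtain ⟨rfl, rfl, -⟩ := hm rfl; norm_num
    | annulus => obtain ⟨rfl, rfl, -⟩ := ha rfl; norm_num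
  | _ => norm_num

theorem creases_ordered (h : Row ty w k f) (hw : 0 < w) {σ : ℝ} (hσ : σ = 1 ∨ σ = -1) :
    0 < f.len + σ * (f.dx * (f.fx + f.gx) + f.dy * (f.fy + f.gy)) := by
  have hw' : (0 : ℝ) < w := by exact_mod_cast hw
  rcases hσ with rfl | rfl <;> cases h <;> dsimp only <;> nlinarith

end Row

/-- The layers form one global strict linear order, which makes the order axioms on overlapping
pieces immediate. -/
theorem rank_injOn {ty : BandType} {w i j : ℕ} (hw : 0 < w) (hi : i < numFolds ty w) (hj : j < numFolds ty w)
    (h : rank ty w i = rank ty w j) : i = j := by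
  have := numFolds_bounds ty w
  unfold rank at h
  split_ifs at h <;> omega

/-- The number of the piece that precedes piece `k`. -/
def pred (ty : BandType) (w k : ℕ) : ℕ := if k = 0 then numFolds ty w - 1 else k - 1

section

variable {ty : BandType} {w i j k : ℕ} {s : ℤ}

theorem pred_lt (hk : k < numFolds ty w) : pred ty w k < numFolds ty w := by
  unfold pred; split_ifs <;> omega

theorem cast_pred : (k : ZMod (ribbon ty w s).n) - 1 = (pred ty w k : ℕ) := by
  have hn := numFolds_bounds ty w
  unfold pred
  split_ifs with h
  · have := cast_last (s := s) (show numFolds ty w - 1 + 1 = numFolds ty w by omega)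
    rw [h]
    push_cast
    linear_combination -this
  · have : ((k - 1 + 1 : ℕ) : ZMod (ribbon ty w s).n) = k := by
      rw [Nat.sub_add_cancel (by omega)]
    push_cast at this
    linear_combination -this

theorem above_iff (hi : i < numFolds ty w) (hj : j < numFolds ty w) :
    (ribbon ty w s).above (i : ZMod (ribbon ty w s).n) (j : ZMod (ribbon ty w s).n) ↔
      s * rank ty w j < s * rank ty w i := by
  exact iff_of_eq (congrArg₂ (fun a b => s * rank ty w a < s * rank ty w b)
    (val_cast (s := s) hj) (val_cast (s := s) hi))

/-- Betweenness does not change when the order is reversed, so the sign `s` drops out of the folding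
axioms. -/
theorem not_between_iff (hw : 0 < w) (hs : s = 1 ∨ s = -1) (hi : i < numFolds ty w) (hj : j < numFolds ty w)
    (hk : k < numFolds ty w) (hki : k ≠ i) (hkj : k ≠ j) :
    ¬ (ribbon ty w s).Between (k : ZMod (ribbon ty w s).n) i j ↔
      (rank ty w i < rank ty w k ↔ rank ty w j < rank ty w k) := by
  rw [RibbonData.Between, above_iff hk hi, above_iff hk hj, xor_iff_not_iff, not_not]
  have h₁ : rank ty w k ≠ rank ty w i := fun h => hki (rank_injOn hw hk hi h)
  have h₂ : rank ty w k ≠ rank ty w j := fun h => hkj (rank_injOn hw hk hj h)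
  rcases hs with rfl | rfl <;> omega

/-- Most folds join layers with nothing between them among the pieces that could cross them. The
three exclusions are the configurations in which the ranks may fail: pieces within the stack, the
outgoing strip against the wrapping, and the fold at `8 * w + 1`, which drops from the stack to the
closing layers. -/
theorem fold_piece_rank (hw : 0 < w) (hi : i < numFolds ty w) (hk : k < numFolds ty w)
    (hki : k ≠ i) (hkp : k ≠ pred ty w i) (h₁ : ¬ (i ≤ 8 * w ∧ k < 8 * w))
    (h₂ : ¬ (i ≤ w ∧ k = 8 * w)) (h₃ : ¬ (i = 8 * w + 1 ∧ (k < 8 * w ∨ 8 * w < k))) :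
    rank ty w (pred ty w i) < rank ty w k ↔ rank ty w i < rank ty w k := by
  have := numFolds_bounds ty w
  unfold pred at *
  unfold rank
  split_ifs at * <;> omega

/-- The heights of the two layers that are joined by a fold of the staircase. -/
theorem rank_fold (hw : w % 2 = 1) (hi : i ≤ 8 * w) :
    (i < w ∧ i % 2 = 0 ∧ rank ty w i = 20 * w - i ∧ i - 1 ≤ rank ty w (pred ty w i) ∧
      rank ty w (pred ty w i) ≤ i) ∨
    (i < w ∧ i % 2 = 1 ∧ rank ty w i = i ∧ rank ty w (pred ty w i) = 20 * w - i + 1) ∨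
    (w ≤ i ∧ rank ty w i = 18 * w - i ∧ (w < i ∧ rank ty w (pred ty w i) = 18 * w - i + 1 ∨
      i = w ∧ rank ty w (pred ty w i) = 19 * w + 1)) := by
  have := numFolds_bounds ty w
  unfold pred
  unfold rank
  split_ifs <;> omega

/-- For folds of one parity, the rank intervals of the wrapping are nested, those of the accordion
are disjoint, and the former enclose the latter. Oddness of `w` makes the spiral end on the upper
side, where it enters the accordion. -/
theorem fold_fold_rank (hw : w % 2 = 1) (hi : i ≤ 8 * w) (hj : j ≤ 8 * w) (hij : i ≠ j) (h : i % 2 = j % 2) :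
    (rank ty w (pred ty w i) < rank ty w (pred ty w j) ↔ rank ty w i < rank ty w (pred ty w j)) ↔
      (rank ty w (pred ty w i) < rank ty w j ↔ rank ty w i < rank ty w j) := by
  rcases rank_fold (ty := ty) hw hi with h₁ | h₁ | h₁ <;>
    rcases rank_fold (ty := ty) hw hj with h₂ | h₂ | h₂ <;> omega

end

end FoldedRibbon

/-! ### The folding axioms, the band type, the absence of crossings and the length. -/

namespace FoldedRibbon

section

variable {ty : BandType} {w i j k : ℕ} {s : ℤ} {f g : Frame} {p : ℂ}

theorem Row.startCorner_eq (h : Row ty w k f) (hw : 0 < w) (σ : ℤ) :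
    (ribbon ty w s).startCorner (k : ZMod (ribbon ty w s).n) σ =
      ⟨f.x - σ * f.fx, f.y - σ * f.fy⟩ := by
  rw [RibbonData.startCorner, h.v_eq, h.foldVec_eq hw]
  apply Complex.ext <;> simp

theorem Row.endCorner_eq (h : Row ty w k f) (hw : 0 < w) (σ : ℤ) :
    (ribbon ty w s).endCorner (k : ZMod (ribbon ty w s).n) σ =
      ⟨f.x + f.len * f.dx + σ * f.gx, f.y + f.len * f.dy + σ * f.gy⟩ := by
  rw [RibbonData.endCorner, h.v_succ, h.foldVec_succ hw]
  apply Complex.ext <;> simp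

/-- The open staircase pieces lie strictly between the two crease lines; the wrapping creases end
before the outgoing strip begins, as `4 * w + 1 ≤ 5 * w`; and the crease at `(32w, 8w)` is far from
the stack and from the later closing pieces. -/
theorem fold_piece_geometry (hw : 0 < w) (hi : Row ty w i f) (hk : Row ty w k g)
    (h₁ : p ∈ (ribbon ty w s).crease (i : ZMod (ribbon ty w s).n))
    (h₂ : p ∈ (ribbon ty w s).piece (k : ZMod (ribbon ty w s).n)) :
    ¬ (i ≤ 8 * w ∧ k < 8 * w) ∧ ¬ (i ≤ w ∧ k = 8 * w) ∧
      ¬ (i = 8 * w + 1 ∧ (k < 8 * w ∨ 8 * w + 1 < k)) := by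
  have hw' : (1 : ℝ) ≤ w := by exact_mod_cast hw
  refine ⟨fun ⟨h, h'⟩ => ?_, fun ⟨h, h'⟩ => ?_, fun ⟨h, h'⟩ => ?_⟩
  · obtain ⟨c, -⟩ := hi.mem_crease_stair hw h h₁
    obtain ⟨c₁, c₂, -⟩ := hk.mem_piece_stair h' h₂
    rcases Nat.mod_two_eq_zero_or_one i with e | e <;> rw [e] at c <;> norm_num at c <;> linarith
  · obtain ⟨-, -, c⟩ := hi.mem_crease_stair hw (by omega) h₁
    obtain ⟨d, -⟩ := hk.mem_piece hw h₂
    rw [abs_lt] at d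
    have : (i : ℝ) ≤ w := by exact_mod_cast h
    cases hk with
    | top => linarith
    | up => have := numFolds_bounds ty w; omega
    | _ => omega
  · obtain ⟨c₁, c₂⟩ := hi.mem_crease_box hw h₁
    have hv := hi.vert_eq
    rw [h, vert_first, Complex.ext_iff] at hv
    rw [abs_lt] at c₁ c₂
    obtain ⟨v₁, v₂⟩ := hv
    dsimp only at v₁ v₂
    rcases h' with h' | h'
    · obtain ⟨d₁, d₂, d₃, -⟩ := hk.mem_piece_stair h' h₂
      have : (k : ℝ) ≤ 8 * w := by exact_mod_cast h'.le
      linarith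
    · obtain ⟨d, -⟩ := hk.mem_piece hw h₂
      rw [abs_lt] at d
      cases hk with
      | left => linarith
      | up => linarith
      | _ => omega

/-- The ribbon `ribbon ty w s` is a folded ribbon knot. -/
noncomputable def knot (ty : BandType) (w : ℕ) (s : ℤ) (hw : 0 < w) (hodd : w % 2 = 1)
    (hs : s = 1 ∨ s = -1) : FoldedRibbonKnot where
  toRibbonData := ribbon ty w s
  three_le := by have := numFolds_bounds ty w; rw [ribbon_n]; omega
  width_pos := by
    change (0 : ℝ) < 6 * w
    positivity
  turn_ne_zero i := by
    obtain ⟨k, f, hk, rfl⟩ := exists_eq_cast i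
    rw [hk.turn_eq hw]
    exact hk.turn_ne_zero
  creases_disjoint i σ hσ := by
    obtain ⟨k, f, hk, rfl⟩ := exists_eq_cast i
    rw [hk.startCorner_eq hw, hk.endCorner_eq hw, hk.dir_eq hw, dot]
    have h₁ := hk.creases_ordered hw (σ := σ)
      (by rcases hσ with rfl | rfl <;> simp)
    have h₂ := hk.dir_sq
    simp only [Complex.sub_re, Complex.sub_im]
    linear_combination h₁ - f.len * h₂
  vertex_regular i j h := by
    obtain ⟨i, f, hi, rfl⟩ := exists_eq_cast i
    obtain ⟨j, g, hj, rfl⟩ := exists_eq_cast j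
    rw [hj.mem_edge hw, hi.v_eq] at h
    obtain ⟨b, b0, b1, bx, bY⟩ := h
    dsimp only at bx bY
    have hf := hi.len_pos hw
    have hg := hj.len_pos hw
    rcases lt_trichotomy i j with h | rfl | h
    · rcases Row.edges_meet hi hj hw h le_rfl hf.le b0 b1 (by linarith) (by linarith) with
        h | ⟨rfl, h, -⟩
      · exact absurd h.2.1 hf.ne
      · right; rw [cast_last h]; simp
    · exact .inl rfl
    · rcases Row.edges_meet hj hi hw h b0 b1 le_rfl hf.le (by linarith) (by linarith) with
        ⟨rfl, -⟩ | h
      · right; push_cast; rfl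
      · exact absurd h.2.2.2 hf.ne
  no_triple i j k hij hjk hik := by
    obtain ⟨i, f, hi, rfl⟩ := exists_eq_cast i
    obtain ⟨j, g, hj, rfl⟩ := exists_eq_cast j
    obtain ⟨k, e, hk, rfl⟩ := exists_eq_cast k
    have hn := numFolds_bounds ty w
    rw [Set.eq_empty_iff_forall_notMem]
    rintro p ⟨⟨h₁, h₂⟩, h₃⟩
    have a₁ := Row.adjacent_of_mem_edges hi hj hw (fun h => hij (by rw [h])) h₁ h₂
    have a₂ := Row.adjacent_of_mem_edges hj hk hw (fun h => hjk (by rw [h])) h₂ h₃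
    have a₃ := Row.adjacent_of_mem_edges hi hk hw (fun h => hik (by rw [h])) h₁ h₃
    omega
  above_irrefl i := lt_irrefl _
  above_xor i j h := by
    obtain ⟨i, f, hi, rfl⟩ := exists_eq_cast i
    obtain ⟨j, g, hj, rfl⟩ := exists_eq_cast j
    rw [above_iff hi.lt hj.lt, above_iff hj.lt hi.lt]
    have : rank ty w i ≠ rank ty w j := fun e => h.1 (by rw [rank_injOn hw hi.lt hj.lt e])
    rw [xor_iff_not_iff]
    rcases hs with rfl | rfl <;> omega
  above_trans i j k _ h₁ h₂ := lt_trans h₂ h₁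
  fold_piece i k hkp hki h := by
    obtain ⟨i, f, hi, rfl⟩ := exists_eq_cast i
    obtain ⟨k, g, hk, rfl⟩ := exists_eq_cast k
    obtain ⟨p, h₁, h₂⟩ := h
    rw [cast_pred] at hkp ⊢
    have hki' : k ≠ i := fun e => hki (by rw [e])
    have hkp' : k ≠ pred ty w i := fun e => hkp (by rw [e])
    rw [not_between_iff hw hs (pred_lt hi.lt) hi.lt hk.lt hkp' hki']
    obtain ⟨g₁, g₂, g₃⟩ := fold_piece_geometry hw hi hk h₁ h₂
    exact fold_piece_rank hw hi.lt hk.lt hki' hkp' g₁ g₂ (by omega)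
  fold_fold i j hij h _ := by
    obtain ⟨i, f, hi, rfl⟩ := exists_eq_cast i
    obtain ⟨j, g, hj, rfl⟩ := exists_eq_cast j
    obtain ⟨p, h₁, h₂⟩ := h
    have hij' : i ≠ j := fun e => hij (by rw [e])
    have hi' : i ≤ 8 * w := by
      by_contra! hc
      exact Row.crease_disjoint_of_far hi hj hw hij' hc h₁ h₂
    have hj' : j ≤ 8 * w := by
      by_contra! hc
      exact Row.crease_disjoint_of_far hj hi hw hij'.symm hc h₂ h₁
    have hm : i % 2 = j % 2 := by
      have c₁ := (hi.mem_crease_stair hw hi' h₁).1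
      have c₂ := (hj.mem_crease_stair hw hj' h₂).1
      exact_mod_cast (by linarith : ((i % 2 : ℕ) : ℝ) = (j % 2 : ℕ))
    have hn := numFolds_bounds ty w
    -- Equal parity rules out consecutive folds, so two folds over each other join four different
    -- pieces.
    have hp : ∀ a b, a % 2 = b % 2 → a ≤ 8 * w → b ≤ 8 * w → a ≠ b →
        pred ty w a ≠ pred ty w b ∧ pred ty w a ≠ b := by
      intro a b _ _ _ _
      unfold pred
      split_ifs <;> omega
    rw [cast_pred, cast_pred, ← not_iff_not,
      not_between_iff hw hs (pred_lt hi.lt) hi.lt (pred_lt hj.lt)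
        (hp j i hm.symm hj' hi' hij'.symm).1 (hp j i hm.symm hj' hi' hij'.symm).2,
      not_between_iff hw hs (pred_lt hi.lt) hi.lt hj.lt (hp i j hm hi' hj' hij').2.symm hij'.symm]
    exact fold_fold_rank hodd hi' hj' hij' hm

theorem knot_toRibbonData (hw : 0 < w) (hodd : w % 2 = 1) (hs : s = 1 ∨ s = -1) :
    (knot ty w s hw hodd hs).toRibbonData = ribbon ty w s := rfl

theorem ribbon_bandType : (ribbon ty w s).bandType = ty := by
  unfold RibbonData.bandType
  rw [ribbon_n]
  cases ty
  · rw [if_pos]; simp only [numFolds]; exact ⟨4 * w + 1, by ring⟩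
  · rw [if_neg]; simp only [numFolds]; rw [Nat.not_odd_iff_even]; exact ⟨4 * w + 2, by ring⟩

theorem ribbon_noCrossings (hw : 0 < w) : (ribbon ty w s).NoCrossings := by
  intro i j hij h₁ h₂
  obtain ⟨i, f, hi, rfl⟩ := exists_eq_cast i
  obtain ⟨j, g, hj, rfl⟩ := exists_eq_cast j
  rw [Set.disjoint_left]
  intro p hp hq
  rcases Row.adjacent_of_mem_edges hi hj hw (fun h => hij (by rw [h])) hp hq with
    rfl | rfl | ⟨rfl, h⟩ | ⟨rfl, h⟩
  · exact h₂ (by push_cast; rfl)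
  · exact h₁ (by push_cast; rfl)
  · exact h₁ (by rw [cast_last h]; simp)
  · exact h₂ (by rw [cast_last h]; simp)

theorem Row.norm_edge (h : Row ty w k f) (hw : 0 < w) :
    ‖(ribbon ty w s).v ((k : ZMod (ribbon ty w s).n) + 1) -
      (ribbon ty w s).v (k : ZMod (ribbon ty w s).n)‖ = f.len := by
  have : (⟨f.x + f.len * f.dx, f.y + f.len * f.dy⟩ : ℂ) - ⟨f.x, f.y⟩ =
      ((f.len : ℝ) : ℂ) * ⟨f.dx, f.dy⟩ := by apply Complex.ext <;> simp
  rw [h.v_succ, h.v_eq, this, norm_mul, Complex.norm_eq_sqrt_sq_add_sq (⟨f.dx, f.dy⟩ : ℂ),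
    h.dir_sq, Real.sqrt_one, mul_one, Complex.norm_real, Real.norm_of_nonneg (h.len_pos hw).le]

theorem ribbonlength_le (hw : 0 < w) : (ribbon ty w s).ribbonlength ≤ 30 := by
  have hw' : (0 : ℝ) < w := by exact_mod_cast hw
  have hn := numFolds_bounds ty w
  rw [RibbonData.ribbonlength, show (ribbon ty w s).width = 6 * w from rfl,
    div_le_iff₀ (by positivity), RibbonData.length]
  -- The staircase has length `16 * w`; each of the at most four other edges is bounded by the
  -- slanted one, of length `40 * w`.
  calc _ ≤ ∑ k ∈ Finset.range (ribbon ty w s).n, (if k < 8 * w then 2 else 40 * w : ℝ) := by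
        refine Finset.sum_le_sum fun k hk => ?_
        obtain ⟨f, hf⟩ := exists_row ty (Finset.mem_range.1 hk)
        rw [hf.norm_edge hw]
        split_ifs with h
        · cases hf with
          | up => omega
          | even => exact le_rfl
          | odd => exact le_rfl
          | _ => omega
        · cases hf with
          | even => omega
          | odd => omega
          | _ => dsimp only; linarith
    _ ≤ ∑ k ∈ Finset.range (8 * w + 4), (if k < 8 * w then 2 else 40 * w : ℝ) := by
        refine Finset.sum_le_sum_of_subset_of_nonneg (Finset.range_mono hn.2) fun k _ _ => ?_
        split_ifs <;> positivity
    _ = 30 * (6 * w) - 4 * w := by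
        have : ∑ k ∈ Finset.range (8 * w), (if k < 8 * w then 2 else 40 * w : ℝ) = 16 * w := by
          rw [Finset.sum_congr rfl fun k hk => if_pos (Finset.mem_range.1 hk)]
          simp
          ring
        simp only [Finset.sum_range_succ, this]
        simp
        ring
    _ ≤ 30 * (6 * w) := by linarith

end

end FoldedRibbon

/-! ### General position and the contributions of the folds. -/

namespace FoldedRibbon

/-- The length of the side `σ` of a piece of the ribbon. -/
def Frame.sideLen (f : Frame) (σ : ℤ) : ℝ :=
  f.len + σ * (f.dx * (f.fx + f.gx) + f.dy * (f.fy + f.gy))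

section

variable {ty : BandType} {w i j k : ℕ} {s σ : ℤ} {f g : Frame} {p : ℂ}

namespace Row

theorem sideLen_pos (h : Row ty w k f) (hw : 0 < w) (hσ : σ = 1 ∨ σ = -1) : 0 < f.sideLen σ :=
  h.creases_ordered hw (by rcases hσ with rfl | rfl <;> simp)

theorem endCorner_eq' (h : Row ty w k f) (hw : 0 < w) (σ : ℤ) :
    (ribbon ty w s).endCorner (k : ZMod (ribbon ty w s).n) σ =
      ⟨f.x - σ * f.fx + f.sideLen σ * f.dx, f.y - σ * f.fy + f.sideLen σ * f.dy⟩ := by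
  rw [h.endCorner_eq hw, Frame.sideLen]
  cases h <;> dsimp only <;> congr 1 <;> ring

theorem mem_side (h : Row ty w k f) (hw : 0 < w) (hσ : σ = 1 ∨ σ = -1) :
    p ∈ segment ℝ ((ribbon ty w s).startCorner (k : ZMod (ribbon ty w s).n) σ)
        ((ribbon ty w s).endCorner (k : ZMod (ribbon ty w s).n) σ) ↔
      ∃ t, 0 ≤ t ∧ t ≤ f.sideLen σ ∧ p.re = f.x - σ * f.fx + t * f.dx ∧
        p.im = f.y - σ * f.fy + t * f.dy := by
  rw [h.startCorner_eq hw, h.endCorner_eq' hw, mem_segment_iff (h.sideLen_pos hw hσ)]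

theorem vertex_even (h : Row ty w k f) : ∃ a b : ℤ, f.x = 2 * a ∧ f.y = 2 * b := by
  cases h with
  | even a h => exact ⟨a, a, by push_cast; ring, by push_cast; ring⟩
  | odd a h => exact ⟨a + 1, a, by push_cast; ring, by push_cast; ring⟩
  | top => exact ⟨4 * w, 4 * w, by push_cast; ring, by push_cast; ring⟩
  | slanted => exact ⟨16 * w, 4 * w, by push_cast; ring, by push_cast; ring⟩
  | down => exact ⟨16 * w, 4 * w, by push_cast; ring, by push_cast; ring⟩
  | left => exact ⟨16 * w, -8 * w, by push_cast; ring, by push_cast; ring⟩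
  | up => exact ⟨0, -8 * w, by push_cast; ring, by push_cast; ring⟩

/-- A parity argument: vertices have even coordinates, whereas a side is offset from its edge by the
odd number `3 * w`. For the slanted edge the relevant form is `3x - 4y`, with offset `15 * w`. -/
theorem vertex_notMem_side (hi : Row ty w i f) (hj : Row ty w j g) (hw : 0 < w)
    (hodd : w % 2 = 1) (hσ : σ = 1 ∨ σ = -1) :
    (ribbon ty w s).v (i : ZMod (ribbon ty w s).n) ∉
      segment ℝ ((ribbon ty w s).startCorner (j : ZMod (ribbon ty w s).n) σ)
        ((ribbon ty w s).endCorner (j : ZMod (ribbon ty w s).n) σ) := by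
  rw [hj.mem_side hw hσ, hi.v_eq]
  rintro ⟨t, -, -, hx, hy⟩
  obtain ⟨a, b, ha, hb⟩ := hi.vertex_even
  dsimp only at hx hy
  rw [ha] at hx
  rw [hb] at hy
  have key : ∀ m n : ℤ, (2 * m + n * w : ℝ) = 0 → n % 2 = 1 → False := by
    intro m n h hn
    have h' : 2 * m + n * w = 0 := by exact_mod_cast h
    have := congrArg (· % 2) h'
    simp [Int.add_emod, Int.mul_emod, hn, (by omega : (w : ℤ) % 2 = 1)] at this
  have hσ' : σ % 2 = 1 := by rcases hσ with rfl | rfl <;> rfl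
  cases hj with
  | even c => exact key (b - c) (-3 * σ) (by push_cast; linarith) (by omega)
  | odd c => exact key (a - c - 1) (3 * σ) (by push_cast; linarith) (by omega)
  | top => exact key (b - 4 * w) (-3 * σ) (by push_cast; linarith) (by omega)
  | slanted => exact key (3 * a - 4 * b - 32 * w) (-15 * σ) (by push_cast; linarith) (by omega)
  | down => exact key (a - 16 * w) (-3 * σ) (by push_cast; linarith) (by omega)
  | left => exact key (b + 8 * w) (3 * σ) (by push_cast; linarith) (by omega)
  | up => exact key a (3 * σ) (by push_cast; linarith) (by omega)

/-- The forms `x`, `y` and `3x - 4y` are those that can be constant on an edge, with an even value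
there. The half-integer alternative for `y` comes from the fold vector `(3w, -3w/2)` of the Möbius
band. -/
theorem corner_odd (h : Row ty w k f) (hodd : w % 2 = 1) (hσ : σ = 1 ∨ σ = -1) :
    ∃ a b c : ℤ, f.x - σ * f.fx = 2 * a + 1 ∧
      (f.y - σ * f.fy = 2 * b + 1 ∨ 2 * (f.y - σ * f.fy) = 2 * b + 1) ∧
      3 * (f.x - σ * f.fx) - 4 * (f.y - σ * f.fy) = 2 * c + 1 := by
  obtain ⟨q, hq⟩ : ∃ q : ℤ, (σ * w : ℝ) = 2 * q + 1 := by
    rcases hσ with rfl | rfl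
    · exact ⟨w / 2, by exact_mod_cast (by omega : (1 : ℤ) * w = 2 * (w / 2) + 1)⟩
    · exact ⟨-(w / 2) - 1, by exact_mod_cast (by omega : (-1 : ℤ) * w = 2 * (-(w / 2) - 1) + 1)⟩
  cases h with
  | even a =>
    refine ⟨a + 3 * q + 1, a + 3 * q + 1, -a - 3 * q - 2, ?_, .inl ?_, ?_⟩ <;> push_cast <;> linarith
  | odd a =>
    refine ⟨a - 3 * q - 1, a - 3 * q - 2, -a + 3 * q + 4, ?_, .inl ?_, ?_⟩ <;> push_cast <;> linarith
  | top =>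
    refine ⟨4 * w + 3 * q + 1, 4 * w + 3 * q + 1, -4 * w - 3 * q - 2, ?_, .inl ?_, ?_⟩ <;>
      push_cast <;> linarith
  | slanted =>
    refine ⟨16 * w + q, 4 * w - 3 * q - 2, 32 * w + 15 * q + 7, ?_, .inl ?_, ?_⟩ <;>
      push_cast <;> linarith
  | down =>
    refine ⟨16 * w + 3 * q + 1, 4 * w - 3 * q - 2, 32 * w + 21 * q + 10, ?_, .inl ?_, ?_⟩ <;>
      push_cast <;> linarith
  | left =>
    refine ⟨16 * w - 3 * q - 2, -8 * w - 3 * q - 2, 80 * w + 3 * q + 1, ?_, .inl ?_, ?_⟩ <;>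
      push_cast <;> linarith
  | up k h p q' β h₁ h₂ hm ha =>
    cases ty with
    | mobius =>
      obtain ⟨-, -, rfl⟩ := hm rfl
      refine ⟨-3 * q - 2, -16 * w + 3 * q + 1, 32 * w - 15 * q - 8, ?_, .inr ?_, ?_⟩ <;>
        push_cast <;> linarith
    | annulus =>
      obtain ⟨-, -, rfl⟩ := ha rfl
      refine ⟨-3 * q - 2, -8 * w + 3 * q + 1, 32 * w - 21 * q - 11, ?_, .inl ?_, ?_⟩ <;>
        push_cast <;> linarith

theorem edge_even (h : Row ty w k f) (hw : 0 < w)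
    (hp : p ∈ (ribbon ty w s).edge (k : ZMod (ribbon ty w s).n)) :
    (∃ a : ℤ, p.re = 2 * a) ∨ (∃ a : ℤ, p.im = 2 * a) ∨ ∃ a : ℤ, 3 * p.re - 4 * p.im = 2 * a := by
  obtain ⟨t, -, -, hx, hy⟩ := (h.mem_edge hw).1 hp
  cases h with
  | even a => exact .inr (.inl ⟨a, by push_cast; linarith⟩)
  | odd a => exact .inl ⟨a + 1, by push_cast; linarith⟩
  | top => exact .inr (.inl ⟨4 * w, by push_cast; linarith⟩)
  | slanted => exact .inr (.inr ⟨32 * w, by push_cast; linarith⟩)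
  | down => exact .inl ⟨16 * w, by push_cast; linarith⟩
  | left => exact .inr (.inl ⟨-8 * w, by push_cast; linarith⟩)
  | up => exact .inl ⟨0, by push_cast; linarith⟩

end Row

theorem ribbon_generalPosition (hw : 0 < w) (hodd : w % 2 = 1) :
    (ribbon ty w s).GeneralPosition := by
  intro i j σ hσ
  obtain ⟨i, f, hi, rfl⟩ := exists_eq_cast i
  obtain ⟨j, g, hj, rfl⟩ := exists_eq_cast j
  refine ⟨hi.vertex_notMem_side hj hw hodd hσ, fun h => ?_⟩
  have h' := hi.edge_even hw h
  rw [hj.startCorner_eq hw] at h'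
  obtain ⟨a, b, c, hx, hy, hl⟩ := hj.corner_odd hodd hσ
  dsimp only at h'
  have key : ∀ m n : ℤ, (2 * m + 1 : ℝ) = 2 * n → False := by
    intro m n h
    have : 2 * m + 1 = 2 * n := by exact_mod_cast h
    omega
  rcases h' with ⟨d, h'⟩ | ⟨d, h'⟩ | ⟨d, h'⟩
  · exact key a d (by linarith)
  · rcases hy with hy | hy
    · exact key b d (by linarith)
    · exact key b (2 * d) (by push_cast; linarith)
  · exact key c d (by linarith)

theorem Row.sign_turn (h : Row ty w k f) :
    SignType.sign (f.px * f.dy - f.py * f.dx) = if k < 8 * w ∧ k % 2 = 1 then 1 else -1 := by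
  have hn := numFolds_bounds ty w
  cases h with
  | odd => rw [if_pos ⟨by omega, by omega⟩]; norm_num
  | up k h p q β h₁ h₂ hm ha =>
    rw [if_neg (by omega)]
    cases ty with
    | mobius => obtain ⟨rfl, rfl, -⟩ := hm rfl; rw [sign_neg (by norm_num)]
    | annulus => obtain ⟨rfl, rfl, -⟩ := ha rfl; rw [sign_neg (by norm_num)]
  | _ => rw [if_neg (by omega), sign_neg (by norm_num)]

theorem rank_pred_lt_iff (hodd : w % 2 = 1) (hk : k < numFolds ty w) :
    (rank ty w (pred ty w k) < rank ty w k ↔ k < w ∧ k % 2 = 0 ∨ 8 * w + 1 < k) ∧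
      rank ty w (pred ty w k) ≠ rank ty w k := by
  have hn := numFolds_bounds ty w
  by_cases h₁ : k ≤ 8 * w
  · rcases rank_fold (ty := ty) hodd h₁ with h₂ | h₂ | h₂ <;> omega
  · have h₂ : rank ty w k = k + 1 - numFolds ty w := by
      rw [rank, if_neg (by omega), if_neg h₁]
    have h₃ : k = 8 * w + 1 ∧ rank ty w (pred ty w k) = 10 * w ∨
        k ≠ 8 * w + 1 ∧ rank ty w (pred ty w k) = k - numFolds ty w := by
      unfold pred rank
      split_ifs <;> omega
    omega

/-- In the wrapping both the turn and the direction of the layer step alternate, so their product is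
constant. In the accordion every step goes down for `s = 1`, or up for `s = -1`, and only the turn
alternates. -/
theorem Row.foldSign_eq (h : Row ty w k f) (hw : 0 < w) (hodd : w % 2 = 1)
    (hs : s = 1 ∨ s = -1) :
    (ribbon ty w s).foldSign (k : ZMod (ribbon ty w s).n) =
      s * if k < w then 1 else if k ≤ 8 * w then -(-1) ^ k else
        if k = 8 * w + 1 then -1 else 1 := by
  have hn := numFolds_bounds ty w
  have hk := h.lt
  obtain ⟨hr, hne⟩ := rank_pred_lt_iff hodd hk
  rw [RibbonData.foldSign, h.turn_eq hw, h.sign_turn, cast_pred, above_iff hk (pred_lt hk)]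
  have hr' : rank ty w k < rank ty w (pred ty w k) ↔
      ¬ (k < w ∧ k % 2 = 0 ∨ 8 * w + 1 < k) := by rw [← hr]; omega
  have hp : (-1 : ℤ) ^ k = if k % 2 = 0 then 1 else -1 := by
    rcases Nat.mod_two_eq_zero_or_one k with e | e
    · rw [(Nat.even_iff.2 e).neg_one_pow, if_pos e]
    · rw [(Nat.odd_iff.2 e).neg_one_pow, if_neg (by omega)]
  rw [hp]
  rcases hs with rfl | rfl
  · simp only [one_mul, hr]
    split_ifs <;> first | rfl | omega
  · simp only [neg_one_mul, neg_lt_neg_iff, hr']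
    split_ifs <;> first | rfl | omega

theorem sum_neg_one_pow_Ico {a b : ℕ} (ha : a % 2 = 1) (hab : a ≤ b) :
    ∑ k ∈ Finset.Ico a b, (-1 : ℤ) ^ k = if b % 2 = 1 then 0 else -1 := by
  rw [Finset.sum_Ico_eq_sub _ hab, neg_one_geom_sum, neg_one_geom_sum]
  simp only [Nat.even_iff]
  split_ifs <;> omega

theorem ribbon_foldSign (hw : 0 < w) (hodd : w % 2 = 1) (hs : s = 1 ∨ s = -1)
    (hk : k < numFolds ty w) :
    (ribbon ty w s).foldSign (k : ZMod (ribbon ty w s).n) =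
      s * if k < w then 1 else if k ≤ 8 * w then -(-1) ^ k else
        if k = 8 * w + 1 then -1 else 1 := by
  obtain ⟨f, hf⟩ := exists_row ty hk
  exact hf.foldSign_eq hw hodd hs

/-- There are `7 * w + 1` alternating terms, an even number because `w` is odd. -/
theorem ribbon_sum_accordion (hw : 0 < w) (hodd : w % 2 = 1) (hs : s = 1 ∨ s = -1) :
    ∑ k ∈ Finset.Ico w (8 * w + 1),
      (ribbon ty w s).foldSign (k : ZMod (ribbon ty w s).n) = 0 := by
  have hn := numFolds_bounds ty w
  rw [Finset.sum_congr rfl (g := fun k => -s * (-1) ^ k), ← Finset.mul_sum,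
    sum_neg_one_pow_Ico hodd (by omega), if_pos (by omega), mul_zero]
  intro k hk
  rw [Finset.mem_Ico] at hk
  rw [ribbon_foldSign hw hodd hs (by omega), if_neg (by omega), if_pos (by omega)]
  ring

/-- The wrapping gives `s * w`; the remaining closing folds give 0 for the Möbius band and `s` for
the annulus. -/
theorem ribbon_foldSum (hw : 0 < w) (hodd : w % 2 = 1) (hs : s = 1 ∨ s = -1) :
    (ribbon ty w s).foldSum = s * (numFolds ty w - 7 * w - 3) := by
  have hn := numFolds_bounds ty w
  rw [RibbonData.foldSum, Finset.range_eq_Ico,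
    ← Finset.sum_Ico_consecutive _ (Nat.zero_le w) (by rw [ribbon_n]; omega),
    ← Finset.sum_Ico_consecutive _ (show w ≤ 8 * w + 1 by omega) (by rw [ribbon_n]; omega),
    ribbon_sum_accordion hw hodd hs]
  have h₁ : ∑ k ∈ Finset.Ico 0 w,
      (ribbon ty w s).foldSign (k : ZMod (ribbon ty w s).n) = s * w := by
    rw [Finset.sum_congr rfl (g := fun _ => s)]
    · simp [mul_comm]
    · intro k hk
      rw [Finset.mem_Ico] at hk
      rw [ribbon_foldSign hw hodd hs (by omega), if_pos hk.2, mul_one]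
  have h₂ : ∑ k ∈ Finset.Ico (8 * w + 1) (ribbon ty w s).n,
      (ribbon ty w s).foldSign (k : ZMod (ribbon ty w s).n) = s * (numFolds ty w - 8 * w - 3) := by
    have hf : ∀ k, 8 * w + 1 ≤ k → k < numFolds ty w →
        (ribbon ty w s).foldSign (k : ZMod (ribbon ty w s).n) = s * if k = 8 * w + 1 then -1 else 1 :=
      fun k h h' => by
        rw [ribbon_foldSign hw hodd hs h', if_neg (by omega), if_neg (by omega)]
    have hf' := fun k (hk : k ∈ Finset.Ico (8 * w + 1) (ribbon ty w s).n) =>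
      hf k (Finset.mem_Ico.1 hk).1 (Finset.mem_Ico.1 hk).2
    rw [Finset.sum_congr rfl hf', ← Finset.mul_sum, ribbon_n]
    cases ty <;> simp [numFolds, Finset.sum_Ico_succ_top]
  rw [h₁, h₂]
  ring

theorem ribbon_diagonalFolds (hw : 0 < w) :
    (ribbon ty w s).DiagonalFolds 0 (8 * w + 1) := by
  have hn := numFolds_bounds ty w
  have key : ∀ j, j < 8 * w + 1 →
      (ribbon ty w s).turn (j : ZMod (ribbon ty w s).n) = -(-1) ^ j := by
    intro j hj
    obtain ⟨f, hf⟩ := exists_row ty (w := w) (k := j) (by omega)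
    rw [hf.turn_eq hw]
    cases hf with
    | even a => simp
    | odd a => simp [pow_succ]
    | top => rw [mul_comm 8 w, show w * 8 = 2 * (4 * w) by ring, pow_mul]; simp
    | _ => omega
  constructor
  · intro j hj
    rw [zero_add, key j hj, abs_neg, abs_pow, abs_neg, abs_one, one_pow]
  · intro j hj
    rw [zero_add, key j (by omega), key (j + 1) hj, pow_succ]
    ring

theorem RibbonData.DiagonalFolds.mono {R : RibbonData} {a b l m : ℕ} (h : R.DiagonalFolds a l)
    (hm : b + m ≤ l) : R.DiagonalFolds (a + b) m := by
  constructor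
  · intro j hj
    rw [add_assoc]
    exact h.1 (b + j) (by omega)
  · intro j hj
    have := h.2 (b + j) (by omega)
    rwa [← add_assoc] at this

theorem ribbon_isWrapping (hw : 0 < w) (hodd : w % 2 = 1) (hs : s = 1 ∨ s = -1) :
    (ribbon ty w s).IsWrapping 0 w s := by
  have hn := numFolds_bounds ty w
  refine ⟨(ribbon_diagonalFolds hw).mono (b := 0) (by omega), fun j hj => ?_⟩
  rw [zero_add, ribbon_foldSign hw hodd hs (by omega), if_pos hj, mul_one]

theorem ribbon_isAccordion (hw : 0 < w) (hodd : w % 2 = 1) (hs : s = 1 ∨ s = -1) :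
    (ribbon ty w s).IsAccordion w (7 * w + 1) := by
  have hn := numFolds_bounds ty w
  refine ⟨?_, fun j hj => ?_⟩
  · have := (ribbon_diagonalFolds (ty := ty) (s := s) hw).mono (b := w) (m := 7 * w + 1) (by omega)
    rwa [zero_add] at this
  · rw [ribbon_foldSign hw hodd hs (by omega), if_neg (by omega), if_pos (by omega),
      ribbon_foldSign hw hodd hs (by omega), if_neg (by omega), if_pos (by omega), pow_succ]
    ring

end

end FoldedRibbon

/-! ### Which edges cross which sides of the boundary. -/

namespace FoldedRibbon

/-- An edge with coordinates `f` crosses the side `σ` of a piece with coordinates `g`. -/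
def Meets (f g : Frame) (σ : ℤ) : Prop :=
  ∃ t u, 0 < t ∧ t < f.len ∧ 0 < u ∧ u < g.sideLen σ ∧
    f.x + t * f.dx = g.x - σ * g.fx + u * g.dx ∧ f.y + t * f.dy = g.y - σ * g.fy + u * g.dy

/-- An integral coordinate inside a step of length 2 that starts at an even integer must be its
midpoint; this turns a geometric crossing into an equation of indices. -/
theorem eq_of_between {m n : ℤ} {t : ℝ} (h0 : 0 < t) (h2 : t < 2) (h : (2 * m : ℝ) + t = n) :
    n = 2 * m + 1 := by
  have h₁ : (2 * m : ℤ) < n := by exact_mod_cast (by linarith : (2 * m : ℝ) < n)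
  have h₂ : n < (2 * m + 2 : ℤ) := by exact_mod_cast (by linarith : (n : ℝ) < 2 * m + 2)
  omega

section

variable {ty : BandType} {w i j k : ℕ} {s σ : ℤ} {f g : Frame} {p : ℂ}

namespace Row

theorem meets_iff (hi : Row ty w i f) (hj : Row ty w j g) (hw : 0 < w) (hσ : σ = 1 ∨ σ = -1) :
    (openSegment ℝ ((ribbon ty w s).v (i : ZMod (ribbon ty w s).n))
        ((ribbon ty w s).v ((i : ZMod (ribbon ty w s).n) + 1)) ∩
      openSegment ℝ ((ribbon ty w s).startCorner (j : ZMod (ribbon ty w s).n) σ)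
        ((ribbon ty w s).endCorner (j : ZMod (ribbon ty w s).n) σ)).Nonempty ↔ Meets f g σ := by
  rw [hi.v_eq, hi.v_succ, hj.startCorner_eq hw, hj.endCorner_eq' hw]
  constructor
  · rintro ⟨p, h₁, h₂⟩
    obtain ⟨t, t0, t1, tx, ty'⟩ := (mem_openSegment_iff (hi.len_pos hw)).1 h₁
    obtain ⟨u, u0, u1, ux, uy⟩ := (mem_openSegment_iff (hj.sideLen_pos hw hσ)).1 h₂
    exact ⟨t, u, t0, t1, u0, u1, by rw [← tx, ux], by rw [← ty', uy]⟩
  · rintro ⟨t, u, t0, t1, u0, u1, hx, hy⟩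
    exact ⟨⟨f.x + t * f.dx, f.y + t * f.dy⟩,
      (mem_openSegment_iff (hi.len_pos hw)).2 ⟨t, t0, t1, rfl, rfl⟩,
      (mem_openSegment_iff (hj.sideLen_pos hw hσ)).2 ⟨u, u0, u1, hx, hy⟩⟩

open Classical in
theorem crossingSign_eq (hi : Row ty w i f) (hj : Row ty w j g) (hw : 0 < w)
    (hs : s = 1 ∨ s = -1) (hσ : σ = 1 ∨ σ = -1) :
    (ribbon ty w s).crossingSign (i : ZMod (ribbon ty w s).n) (j : ZMod (ribbon ty w s).n) σ =
      s * if Meets f g σ then (if rank ty w j < rank ty w i then 1 else -1) *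
        (SignType.sign (f.dx * g.dy - f.dy * g.dx) : ℤ) else 0 := by
  rw [RibbonData.crossingSign, above_iff hi.lt hj.lt, hi.dir_eq hw, hj.dir_eq hw, cross]
  simp only [hi.meets_iff hj hw hσ]
  split_ifs with h₁ h₂ h₃ h₄
  · rcases hs with rfl | rfl
    · ring
    · omega
  · rcases hs with rfl | rfl
    · omega
    · ring
  · rcases hs with rfl | rfl
    · omega
    · ring
  · rcases hs with rfl | rfl
    · ring
    -- Reversing the order could go wrong only at equal ranks, that is for a piece and its own side,
    -- which are parallel and have sign 0.
    · have : i = j := rank_injOn hw hi.lt hj.lt (by omega)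
      subst this
      have hd := hi.dir_eq (s := -1) hw
      rw [hj.dir_eq hw, Complex.ext_iff] at hd
      obtain ⟨h₁, h₂⟩ := hd
      dsimp only at h₁ h₂
      rw [h₁, h₂, mul_comm f.dx, sub_self]
      simp
  · ring

/-- This side belongs to the translate of the staircase by `(3w, 3w)`, which amounts to `3 * w`
steps along it. As `3 * w` is odd, horizontal sides meet vertical edges. -/
theorem meets_even_pos {b : ℕ} (hi : Row ty w i f) (hj : Row ty w (2 * b) g) (hb : b < 4 * w)
    (hw : 0 < w) (hodd : w % 2 = 1) : Meets f g 1 ↔ i = 2 * b + 3 * w ∧ i ≤ 8 * w := by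
  have hw' : (1 : ℝ) ≤ w := by exact_mod_cast hw
  have hn := numFolds_bounds ty w
  have hb' : (b : ℝ) < 4 * w := by exact_mod_cast hb
  generalize hl : 2 * b = l at hj
  cases hj with
  | even b' h =>
    obtain rfl : b' = b := by omega
    constructor
    · rintro ⟨t, u, t0, t1, u0, u1, hx, hy⟩
      simp only [Frame.sideLen] at t1 u1 hx hy
      push_cast at hx hy u1
      cases hi with
      | even a =>
        exfalso
        have : (2 * a : ℤ) = 2 * b' + 3 * w := by
          exact_mod_cast (by linarith : (2 * a : ℝ) = 2 * b' + 3 * w)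
        omega
      | odd a h =>
        have := eq_of_between (m := a) (n := 2 * b' + 3 * w) t0 t1 (by push_cast; linarith)
        omega
      | top =>
        exfalso
        have : (8 * w : ℤ) = 2 * b' + 3 * w := by
          exact_mod_cast (by linarith : (8 * w : ℝ) = 2 * b' + 3 * w)
        omega
      | _ => exfalso; linarith
    · rintro ⟨h, h'⟩
      cases hi with
      | odd a ha =>
        have : (2 * a + 1 : ℝ) = 2 * b' + 3 * w := by exact_mod_cast (by omega)
        -- Edge and side both have length 2 and cross at their midpoints.
        refine ⟨1, 1, ?_, ?_, ?_, ?_, ?_, ?_⟩ <;> push_cast [Frame.sideLen] <;> linarith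
      | _ => omega
  | _ => omega

theorem meets_odd_neg {b : ℕ} (hi : Row ty w i f) (hj : Row ty w (2 * b + 1) g) (hb : b < 4 * w)
    (hw : 0 < w) (hodd : w % 2 = 1) : Meets f g (-1) ↔ i = 2 * b + 1 + 3 * w ∧ i ≤ 8 * w := by
  have hw' : (1 : ℝ) ≤ w := by exact_mod_cast hw
  have hn := numFolds_bounds ty w
  have hb' : (b : ℝ) < 4 * w := by exact_mod_cast hb
  generalize hl : 2 * b + 1 = l at hj
  cases hj with
  | odd b' h =>
    obtain rfl : b' = b := by omega
    constructor
    · rintro ⟨t, u, t0, t1, u0, u1, hx, hy⟩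
      simp only [Frame.sideLen] at t1 u1 hx hy
      push_cast at hx hy u1
      cases hi with
      | even a h =>
        have := eq_of_between (m := a) (n := 2 * b' + 2 + 3 * w) t0 t1 (by push_cast; linarith)
        omega
      | odd a =>
        exfalso
        have : (2 * a + 2 : ℤ) = 2 * b' + 2 + 3 * w := by
          exact_mod_cast (by linarith : (2 * a + 2 : ℝ) = 2 * b' + 2 + 3 * w)
        omega
      | top =>
        have := eq_of_between (m := b') (n := 8 * w - 3 * w) u0 (by linarith)
          (by push_cast; linarith)
        omega
      | _ => exfalso; linarith
    · rintro ⟨h, h'⟩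
      cases hi with
      | even a ha =>
        have : (2 * a : ℝ) = 2 * b' + 1 + 3 * w := by exact_mod_cast (by omega)
        refine ⟨1, 1, ?_, ?_, ?_, ?_, ?_, ?_⟩ <;> push_cast [Frame.sideLen] <;> linarith
      | top =>
        have : (8 * w : ℝ) = 2 * b' + 1 + 3 * w := by exact_mod_cast (by omega)
        refine ⟨1, 1, ?_, ?_, ?_, ?_, ?_, ?_⟩ <;> push_cast [Frame.sideLen] <;> linarith
      | _ => omega
  | up => omega
  | _ => omega

/-- Here the translate is by `-(3w, 3w)`. It starts below the origin and so must also cross the last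
edge, which ascends along the `y`-axis. -/
theorem meets_even_neg {b : ℕ} (hi : Row ty w i f) (hj : Row ty w (2 * b) g) (hb : b < 4 * w)
    (hw : 0 < w) (hodd : w % 2 = 1) : Meets f g (-1) ↔
      i + 3 * w = 2 * b ∨ i + 1 = numFolds ty w ∧ 2 * b + 1 = 3 * w := by
  have hw' : (1 : ℝ) ≤ w := by exact_mod_cast hw
  have hn := numFolds_bounds ty w
  have hb' : (b : ℝ) < 4 * w := by exact_mod_cast hb
  generalize hl : 2 * b = l at hj
  cases hj with
  | even b' h =>
    obtain rfl : b' = b := by omega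
    constructor
    · rintro ⟨t, u, t0, t1, u0, u1, hx, hy⟩
      simp only [Frame.sideLen] at t1 u1 hx hy
      push_cast at hx hy u1
      cases hi with
      | even a =>
        exfalso
        have : (2 * a : ℤ) = 2 * b' - 3 * w := by
          exact_mod_cast (by linarith : (2 * a : ℝ) = 2 * b' - 3 * w)
        omega
      | odd a h =>
        have := eq_of_between (m := a) (n := 2 * b' - 3 * w) t0 t1 (by push_cast; linarith)
        omega
      | up k h =>
        have := eq_of_between (m := b') (n := 3 * w) u0 (by linarith) (by push_cast; linarith)
        omega
      | _ => exfalso; linarith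
    · rintro (h | ⟨h, h'⟩)
      · cases hi with
        | odd a ha =>
          have : (2 * a + 1 + 3 * w : ℝ) = 2 * b' := by exact_mod_cast (by omega)
          refine ⟨1, 1, ?_, ?_, ?_, ?_, ?_, ?_⟩ <;> push_cast [Frame.sideLen] <;>
            linarith
        | _ => omega
      · cases hi with
        | up =>
          have : (2 * b' + 1 : ℝ) = 3 * w := by exact_mod_cast h'
          refine ⟨16 * w - 1, 1, ?_, ?_, ?_, ?_, ?_, ?_⟩ <;> push_cast [Frame.sideLen] <;> linarith
        | left h'' => subst h''; simp [numFolds] at h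
        | _ => omega
  | up => omega
  | _ => omega

theorem meets_odd_pos {b : ℕ} (hi : Row ty w i f) (hj : Row ty w (2 * b + 1) g) (hb : b < 4 * w)
    (hw : 0 < w) (hodd : w % 2 = 1) : Meets f g 1 ↔ i + 3 * w = 2 * b + 1 := by
  have hw' : (1 : ℝ) ≤ w := by exact_mod_cast hw
  have hn := numFolds_bounds ty w
  have hb' : (b : ℝ) + 1 ≤ 4 * w := by exact_mod_cast hb
  generalize hl : 2 * b + 1 = l at hj
  cases hj with
  | odd b' h =>
    obtain rfl : b' = b := by omega
    constructor
    · rintro ⟨t, u, t0, t1, u0, u1, hx, hy⟩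
      simp only [Frame.sideLen] at t1 u1 hx hy
      push_cast at hx hy u1
      cases hi with
      | even a h =>
        have := eq_of_between (m := a) (n := 2 * b' + 2 - 3 * w) t0 t1 (by push_cast; linarith)
        omega
      | odd a =>
        exfalso
        have : (2 * a + 2 : ℤ) = 2 * b' + 2 - 3 * w := by
          exact_mod_cast (by linarith : (2 * a + 2 : ℝ) = 2 * b' + 2 - 3 * w)
        omega
      | up =>
        exfalso
        have : (2 * b' + 2 : ℤ) = 3 * w := by
          exact_mod_cast (by linarith : (2 * b' + 2 : ℝ) = 3 * w)
        omega
      | _ => exfalso; linarith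
    · intro h
      cases hi with
      | even a ha =>
        have : (2 * a + 3 * w : ℝ) = 2 * b' + 1 := by exact_mod_cast (by omega)
        refine ⟨1, 1, ?_, ?_, ?_, ?_, ?_, ?_⟩ <;> push_cast [Frame.sideLen] <;> linarith
      | _ => omega
  | up => omega
  | _ => omega

/-- The closing polygon is traversed clockwise, so the left sides of its pieces are outer sides: the
line of each leaves the whole centreline on one side. -/
theorem not_meets_top_pos (hi : Row ty w i f) (hj : Row ty w j g) (hj' : 8 * w ≤ j) (hw : 0 < w) :
    ¬ Meets f g 1 := by
  have hw' : (1 : ℝ) ≤ w := by exact_mod_cast hw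
  have hn := numFolds_bounds ty w
  have ha : ∀ {a : ℕ}, a < 4 * w → (a : ℝ) + 1 ≤ 4 * w := fun h => by exact_mod_cast h
  have ha' : ∀ a : ℕ, (0 : ℝ) ≤ a := fun a => a.cast_nonneg
  rintro ⟨t, u, t0, t1, u0, u1, hx, hy⟩
  simp only [Frame.sideLen] at t1 u1
  push_cast at hx hy u1
  cases hi with
  | even a h =>
    have := ha h
    have := ha' a
    cases hj <;> first | omega | nlinarith
  | odd a h =>
    have := ha h
    have := ha' a
    cases hj <;> first | omega | nlinarith
  | _ => cases hj <;> first | omega | (cases ty <;> contradiction) | nlinarith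

/-- The inner side runs at height `5 * w` from the diagonal to the right; it crosses one staircase
edge near its start and the next closing edge near its end. -/
theorem meets_top_neg (hi : Row ty w i f) (hj : Row ty w (8 * w) g) (hw : 0 < w)
    (hodd : w % 2 = 1) : Meets f g (-1) ↔ i = 5 * w ∨ i = 8 * w + 1 := by
  have hw' : (1 : ℝ) ≤ w := by exact_mod_cast hw
  have hn := numFolds_bounds ty w
  generalize hl : 8 * w = l at hj
  cases hj with
  | top α h₁ h₂ hm hα =>
    constructor
    · rintro ⟨t, u, t0, t1, u0, u1, hx, hy⟩
      simp only [Frame.sideLen] at t1 u1 hx hy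
      push_cast at hx hy u1
      cases hi with
      | even a =>
        exfalso
        have : (2 * a : ℤ) = 5 * w := by exact_mod_cast (by linarith : (2 * a : ℝ) = 5 * w)
        omega
      | odd a h =>
        have := eq_of_between (m := a) (n := 5 * w) t0 t1 (by push_cast; linarith)
        omega
      | slanted => omega
      | down => omega
      | _ => exfalso; linarith
    · rintro (h | h)
      · cases hi with
        | odd a ha =>
          have : (2 * a + 1 : ℝ) = 5 * w := by exact_mod_cast (by omega)
          refine ⟨1, 1, ?_, ?_, ?_, ?_, ?_, ?_⟩ <;> push_cast [Frame.sideLen] <;>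
            nlinarith
        | _ => omega
      · cases hi with
        | slanted h' =>
          rw [hm h']
          refine ⟨5 * w, 23 * w, ?_, ?_, ?_, ?_, ?_, ?_⟩ <;> push_cast [Frame.sideLen] <;> linarith
        | down h' =>
          rw [hα h']
          refine ⟨3 * w, 27 * w, ?_, ?_, ?_, ?_, ?_, ?_⟩ <;> push_cast [Frame.sideLen] <;> linarith
        | _ => omega
  | _ => omega

theorem meets_first_neg (hi : Row ty w i f) (hj : Row ty w (8 * w + 1) g) (hw : 0 < w) :
    Meets f g (-1) ↔ i = 8 * w ∨ i = 8 * w + 2 := by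
  have hw' : (1 : ℝ) ≤ w := by exact_mod_cast hw
  have hn := numFolds_bounds ty w
  have ha : ∀ {a : ℕ}, a < 4 * w → (a : ℝ) + 1 ≤ 4 * w := fun h => by exact_mod_cast h
  have ha' : ∀ a : ℕ, (0 : ℝ) ≤ a := fun a => a.cast_nonneg
  generalize hl : 8 * w + 1 = l at hj
  cases hj with
  | slanted hty =>
    subst hty
    constructor
    · rintro ⟨t, u, t0, t1, u0, u1, hx, hy⟩
      simp only [Frame.sideLen] at t1 u1 hx hy
      push_cast at hx hy u1
      cases hi with
      | even a h => have := ha h; have := ha' a; exfalso; linarith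
      | odd a h => have := ha h; have := ha' a; exfalso; linarith
      | top => exact .inl rfl
      | up k h => simp only [numFolds] at h; omega
      | slanted => exfalso; linarith
      | down h => exact absurd h (by simp)
      | left h => exact absurd h (by simp)
    · rintro (h | h)
      · cases hi with
        | top =>
          refine ⟨19 * w, 5 * w, ?_, ?_, ?_, ?_, ?_, ?_⟩ <;> push_cast [Frame.sideLen] <;> linarith
        | _ => omega
      · cases hi with
        | up =>
          refine ⟨15 / 4 * w, 155 / 4 * w, ?_, ?_, ?_, ?_, ?_, ?_⟩ <;> push_cast [Frame.sideLen] <;> linarith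
        | left h' => exact absurd h' (by simp)
        | _ => omega
  | down hty =>
    subst hty
    constructor
    · rintro ⟨t, u, t0, t1, u0, u1, hx, hy⟩
      simp only [Frame.sideLen] at t1 u1 hx hy
      push_cast at hx hy u1
      cases hi with
      | even a h => have := ha h; have := ha' a; exfalso; linarith
      | odd a h => have := ha h; have := ha' a; exfalso; linarith
      | top => exact .inl rfl
      | left => exact .inr rfl
      | slanted h => exact absurd h (by simp)
      | _ => exfalso; linarith
    · rintro (h | h)
      · cases hi with
        | top =>
          refine ⟨21 * w, 3 * w, ?_, ?_, ?_, ?_, ?_, ?_⟩ <;> push_cast [Frame.sideLen] <;> linarith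
        | _ => omega
      · cases hi with
        | left =>
          refine ⟨3 * w, 27 * w, ?_, ?_, ?_, ?_, ?_, ?_⟩ <;> push_cast [Frame.sideLen] <;> linarith
        | up k h' => simp only [numFolds] at h'; omega
        | _ => omega
  | up => omega
  | _ => omega

theorem meets_up_neg (hi : Row ty w i f) (hj : Row ty w j g) (hw : 0 < w) (hodd : w % 2 = 1)
    (hn : j + 1 = numFolds ty w) : Meets f g (-1) ↔ i + 1 = j ∨ i + 1 = 3 * w := by
  have hw' : (1 : ℝ) ≤ w := by exact_mod_cast hw
  have hn' := numFolds_bounds ty w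
  cases hj with
  | up j hj p q β h₁ h₂ hm hβ =>
    have hβ' : 0 < (β * w : ℝ) := by nlinarith
    constructor
    · rintro ⟨t, u, t0, t1, u0, u1, hx, hy⟩
      simp only [Frame.sideLen] at t1 u1 hx hy
      push_cast at hx hy u1
      cases hi with
      | even a h =>
        have := eq_of_between (m := a) (n := 3 * w) t0 t1 (by push_cast; linarith)
        omega
      | odd a =>
        exfalso
        have : (2 * a + 2 : ℤ) = 3 * w := by exact_mod_cast (by linarith : (2 * a + 2 : ℝ) = 3 * w)
        omega
      | slanted h => subst h; simp only [numFolds] at hj; omega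
      | left h => subst h; simp only [numFolds] at hj; omega
      | _ => exfalso; linarith
    · rintro (h | h)
      · cases hi with
        | slanted h' =>
          rw [(hm h').2.2]
          refine ⟨145 / 4 * w, 15 / 4 * w, ?_, ?_, ?_, ?_, ?_, ?_⟩ <;> push_cast [Frame.sideLen] <;> linarith
        | left h' =>
          rw [(hβ h').2.2]
          refine ⟨29 * w, 3 * w, ?_, ?_, ?_, ?_, ?_, ?_⟩ <;> push_cast [Frame.sideLen] <;> linarith
        | down h' => subst h'; simp only [numFolds] at hj; omega
        | _ => omega
      · cases hi with
        | even a =>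
          have : (2 * a + 1 : ℝ) = 3 * w := by exact_mod_cast h
          refine ⟨1, 19 * w - 1 + β * w, ?_, ?_, ?_, ?_, ?_, ?_⟩ <;> push_cast [Frame.sideLen] <;> linarith
        | _ => omega
  | left h => subst h; simp [numFolds] at hn
  | _ => omega

end Row

end

end FoldedRibbon

/-! ### Crossing signs and the ribbon linking number. -/

namespace FoldedRibbon

section

variable {ty : BandType} {w i j k : ℕ} {s σ : ℤ} {f g : Frame} {p : ℂ}

/-- The sign of the crossing of edge `i` with a side of piece `j`, for a positive wrapping. -/
noncomputable def pairSign (ty : BandType) (w i j : ℕ) (f g : Frame) : ℤ :=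
  (if rank ty w j < rank ty w i then 1 else -1) * (SignType.sign (f.dx * g.dy - f.dy * g.dx) : ℤ)

/-- The sum of the signs of all crossings of the centreline with the side `σ` of piece `j`. -/
noncomputable def sideSum (ty : BandType) (w : ℕ) (s : ℤ) (j : ℕ) (σ : ℤ) : ℤ :=
  ∑ i ∈ Finset.range (ribbon ty w s).n,
    (ribbon ty w s).crossingSign (i : ZMod (ribbon ty w s).n) (j : ZMod (ribbon ty w s).n) σ

theorem Row.crossingSign_of_meets (hi : Row ty w i f) (hj : Row ty w j g) (hw : 0 < w)
    (hs : s = 1 ∨ s = -1) (hσ : σ = 1 ∨ σ = -1) (h : Meets f g σ) :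
    (ribbon ty w s).crossingSign (i : ZMod (ribbon ty w s).n) (j : ZMod (ribbon ty w s).n) σ =
      s * pairSign ty w i j f g := by
  rw [hi.crossingSign_eq hj hw hs hσ, if_pos h, pairSign]

theorem Row.crossingSign_of_not_meets (hi : Row ty w i f) (hj : Row ty w j g) (hw : 0 < w)
    (hs : s = 1 ∨ s = -1) (hσ : σ = 1 ∨ σ = -1) (h : ¬ Meets f g σ) :
    (ribbon ty w s).crossingSign (i : ZMod (ribbon ty w s).n) (j : ZMod (ribbon ty w s).n) σ =
      0 := by
  rw [hi.crossingSign_eq hj hw hs hσ, if_neg h, mul_zero]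

theorem Row.sideSum_eq_zero (hj : Row ty w j g) (hw : 0 < w) (hs : s = 1 ∨ s = -1)
    (hσ : σ = 1 ∨ σ = -1) (h : ∀ i f, Row ty w i f → ¬ Meets f g σ) :
    sideSum ty w s j σ = 0 := by
  refine Finset.sum_eq_zero fun i hi => ?_
  obtain ⟨f, hf⟩ := exists_row ty (Finset.mem_range.1 hi)
  exact hf.crossingSign_of_not_meets hj hw hs hσ (h i f hf)

theorem Row.sideSum_eq_single (hj : Row ty w j g) (hw : 0 < w) (hs : s = 1 ∨ s = -1)
    (hσ : σ = 1 ∨ σ = -1) {a : ℕ} {e : Frame} (ha : Row ty w a e)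
    (h : ∀ i f, Row ty w i f → (Meets f g σ ↔ i = a)) :
    sideSum ty w s j σ = s * pairSign ty w a j e g := by
  rw [sideSum, Finset.sum_eq_single a]
  · exact ha.crossingSign_of_meets hj hw hs hσ ((h a e ha).2 rfl)
  · intro i hi hia
    obtain ⟨f, hf⟩ := exists_row ty (Finset.mem_range.1 hi)
    exact hf.crossingSign_of_not_meets hj hw hs hσ fun hm => hia ((h i f hf).1 hm)
  · exact fun h => absurd (Finset.mem_range.2 ha.lt) h

theorem Row.sideSum_eq_add (hj : Row ty w j g) (hw : 0 < w) (hs : s = 1 ∨ s = -1)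
    (hσ : σ = 1 ∨ σ = -1) {a b : ℕ} {d e : Frame} (ha : Row ty w a d) (hb : Row ty w b e)
    (hab : a ≠ b) (h : ∀ i f, Row ty w i f → (Meets f g σ ↔ i = a ∨ i = b)) :
    sideSum ty w s j σ = s * (pairSign ty w a j d g + pairSign ty w b j e g) := by
  rw [sideSum, Finset.sum_eq_add a b hab, mul_add,
    ha.crossingSign_of_meets hj hw hs hσ ((h a d ha).2 (.inl rfl)),
    hb.crossingSign_of_meets hj hw hs hσ ((h b e hb).2 (.inr rfl))]
  · intro i hi hia
    obtain ⟨f, hf⟩ := exists_row ty (Finset.mem_range.1 hi)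
    exact hf.crossingSign_of_not_meets hj hw hs hσ fun hm => (not_or.2 hia) ((h i f hf).1 hm)
  · exact fun h => absurd (Finset.mem_range.2 ha.lt) h
  · exact fun h => absurd (Finset.mem_range.2 hb.lt) h

theorem Row.dir_stair (h : Row ty w k f) (hk : k ≤ 8 * w) :
    k % 2 = 0 ∧ f.dx = 1 ∧ f.dy = 0 ∨ k % 2 = 1 ∧ f.dx = 0 ∧ f.dy = 1 := by
  have hn := numFolds_bounds ty w
  cases h with
  | even => exact .inl ⟨by omega, rfl, rfl⟩
  | odd => exact .inr ⟨by omega, rfl, rfl⟩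
  | top => exact .inl ⟨by omega, rfl, rfl⟩
  | _ => omega

theorem neg_one_pow_eq_ite (k : ℕ) : (-1 : ℤ) ^ k = if k % 2 = 0 then 1 else -1 := by
  rcases Nat.mod_two_eq_zero_or_one k with e | e
  · rw [(Nat.even_iff.2 e).neg_one_pow, if_pos e]
  · rw [(Nat.odd_iff.2 e).neg_one_pow, if_neg (by omega)]

/-- Piece `j + 3w` always lies in the accordion. A wrapping piece `j` is alternately above and below
it, which cancels the alternation of the directions; an accordion piece `j` is always above, so the
alternation of the directions remains. -/
theorem pairSign_later (hi : Row ty w i f) (hj : Row ty w j g) (hw : 0 < w) (hodd : w % 2 = 1)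
    (h : i = j + 3 * w) (h' : i ≤ 8 * w) :
    pairSign ty w i j f g = if j < w then 1 else (-1) ^ j := by
  rw [pairSign, neg_one_pow_eq_ite]
  have hr : rank ty w j < rank ty w i ↔ j < w ∧ j % 2 = 1 := by
    unfold rank; split_ifs <;> omega
  simp only [hr]
  rcases hi.dir_stair h' with ⟨e, hx, hy⟩ | ⟨e, hx, hy⟩ <;>
    rcases hj.dir_stair (by omega) with ⟨e', hx', hy'⟩ | ⟨e', hx', hy'⟩ <;>
    first | omega | (rw [hx, hy, hx', hy']; norm_num [e'])

theorem pairSign_earlier (hi : Row ty w i f) (hj : Row ty w j g) (hw : 0 < w) (hodd : w % 2 = 1)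
    (h : i + 3 * w = j) (h' : j ≤ 8 * w) :
    pairSign ty w i j f g = if i < w then 1 else (-1) ^ i := by
  rw [pairSign, neg_one_pow_eq_ite]
  have hr : rank ty w j < rank ty w i ↔ w ≤ i ∨ i % 2 = 0 := by
    unfold rank; split_ifs <;> omega
  simp only [hr]
  rcases hi.dir_stair (by omega) with ⟨e, hx, hy⟩ | ⟨e, hx, hy⟩ <;>
    rcases hj.dir_stair h' with ⟨e', hx', hy'⟩ | ⟨e', hx', hy'⟩ <;>
    first | omega | (rw [hx, hy, hx', hy']; norm_num [e]; try (split_ifs <;> omega))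

theorem Row.dir_up (h : Row ty w k f) (hn : k + 1 = numFolds ty w) : f.dx = 0 ∧ f.dy = 1 := by
  have := numFolds_bounds ty w
  cases h with
  | up => exact ⟨rfl, rfl⟩
  | left h => subst h; simp [numFolds] at hn
  | _ => omega

/-- The crossings of the centreline with the boundary component through the right-hand corners of
the staircase. -/
theorem sideSum_same (hw : 0 < w) (hodd : w % 2 = 1) (hs : s = 1 ∨ s = -1) (hj : j ≤ 8 * w) :
    sideSum ty w s j ((-1) ^ j) =
      s * if j ≤ 5 * w then (if j < w then 1 else (-1) ^ j) else 0 := by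
  have hn := numFolds_bounds ty w
  obtain ⟨g, hg⟩ := exists_row ty (w := w) (k := j) (by omega)
  have hσ := neg_one_pow_eq_or ℤ j
  have key : ∀ i f, Row ty w i f → (Meets f g ((-1) ^ j) ↔ i = j + 3 * w ∧ i ≤ 8 * w) := by
    intro i f hf
    rcases hj.eq_or_lt with h | h
    · have e : (-1 : ℤ) ^ j = 1 := by rw [neg_one_pow_eq_ite, if_pos (by omega)]
      rw [e]
      exact ⟨fun hm => absurd hm (hf.not_meets_top_pos hg h.ge hw), fun h => by omega⟩
    · rcases Nat.even_or_odd' j with ⟨b, rfl | rfl⟩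
      · have e : (-1 : ℤ) ^ (2 * b) = 1 := by rw [neg_one_pow_eq_ite, if_pos (by omega)]
        rw [e]
        exact hf.meets_even_pos hg (by omega) hw hodd
      · have e : (-1 : ℤ) ^ (2 * b + 1) = -1 := by rw [neg_one_pow_eq_ite, if_neg (by omega)]
        rw [e]
        exact hf.meets_odd_neg hg (by omega) hw hodd
  split_ifs with h₁ h₂
  · obtain ⟨e, he⟩ := exists_row ty (w := w) (k := j + 3 * w) (by omega)
    rw [hg.sideSum_eq_single hw hs hσ he fun i f hf => by rw [key i f hf]; omega,
      pairSign_later he hg hw hodd rfl (by omega), if_pos h₂]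
  · obtain ⟨e, he⟩ := exists_row ty (w := w) (k := j + 3 * w) (by omega)
    rw [hg.sideSum_eq_single hw hs hσ he fun i f hf => by rw [key i f hf]; omega,
      pairSign_later he hg hw hodd rfl (by omega), if_neg h₂]
  · rw [hg.sideSum_eq_zero hw hs hσ fun i f hf => by rw [key i f hf]; omega, mul_zero]

/-- The three summands record the crossing with the last, ascending edge at `j = 3w - 1`, the
crossing with edge `j - 3w` (wrapping for `j < 4w`), and the crossing of the top piece with the next
closing edge, which lies below it. -/
theorem sideSum_opposite (hw : 0 < w) (hodd : w % 2 = 1) (hs : s = 1 ∨ s = -1) (hj : j ≤ 8 * w) :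
    sideSum ty w s j (-(-1) ^ j) =
      s * ((if j = 3 * w - 1 then 1 else 0) +
        (if j < 3 * w then 0 else if j < 4 * w then 1 else -(-1) ^ j) +
        if j = 8 * w then -1 else 0) := by
  have hn := numFolds_bounds ty w
  obtain ⟨g, hg⟩ := exists_row ty (w := w) (k := j) (by omega)
  have hσ : -(-1 : ℤ) ^ j = 1 ∨ -(-1 : ℤ) ^ j = -1 := by
    rcases neg_one_pow_eq_or ℤ j with h | h <;> rw [h] <;> simp
  rcases hj.eq_or_lt with rfl | h
  · have e : (-1 : ℤ) ^ (8 * w) = 1 := by rw [neg_one_pow_eq_ite, if_pos (by omega)]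
    rw [e] at hσ ⊢
    obtain ⟨c, hc⟩ := exists_row ty (w := w) (k := 5 * w) (by omega)
    obtain ⟨d, hd⟩ := exists_row ty (w := w) (k := 8 * w + 1) (by omega)
    rw [hg.sideSum_eq_add hw hs hσ hc hd (by omega) fun i f hf => hf.meets_top_neg hg hw hodd,
      pairSign_earlier hc hg hw hodd (by omega) le_rfl, if_neg (by omega), neg_one_pow_eq_ite,
      if_neg (by omega), if_neg (by omega), if_neg (by omega), if_neg (by omega), if_pos rfl,
      pairSign]
    have hr : ¬ rank ty w (8 * w) < rank ty w (8 * w + 1) := by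
      unfold rank; split_ifs <;> omega
    obtain ⟨-, hx, hy⟩ : 8 * w % 2 = 0 ∧ g.dx = 1 ∧ g.dy = 0 := by
      rcases hg.dir_stair le_rfl with h | h <;> omega
    have hd' : 0 < -d.dy := by
      generalize hl : 8 * w + 1 = l at hd
      cases hd with
      | slanted => norm_num
      | down => norm_num
      | _ => omega
    rw [if_neg hr, hx, hy, mul_zero, mul_one, zero_sub, sign_pos hd']
    rfl
  · have key : ∀ i f, Row ty w i f → (Meets f g (-(-1) ^ j) ↔
        i + 3 * w = j ∨ i + 1 = numFolds ty w ∧ j + 1 = 3 * w) := by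
      intro i f hf
      rcases Nat.even_or_odd' j with ⟨b, rfl | rfl⟩
      · have e : (-1 : ℤ) ^ (2 * b) = 1 := by rw [neg_one_pow_eq_ite, if_pos (by omega)]
        rw [e]
        exact hf.meets_even_neg hg (by omega) hw hodd
      · have e : (-1 : ℤ) ^ (2 * b + 1) = -1 := by rw [neg_one_pow_eq_ite, if_neg (by omega)]
        rw [e, neg_neg, hf.meets_odd_pos hg (by omega) hw hodd]
        omega
    rw [if_neg h.ne, add_zero]
    by_cases h₁ : j = 3 * w - 1
    · obtain ⟨c, hc⟩ := exists_row ty (w := w) (k := numFolds ty w - 1) (by omega)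
      have hr : ¬ rank ty w j < rank ty w (numFolds ty w - 1) := by
        unfold rank; split_ifs <;> omega
      obtain ⟨hx, hy⟩ := hc.dir_up (by omega)
      obtain ⟨-, hx', hy'⟩ : j % 2 = 0 ∧ g.dx = 1 ∧ g.dy = 0 := by
        rcases hg.dir_stair hj with h | h <;> omega
      rw [hg.sideSum_eq_single hw hs hσ hc fun i f hf => by rw [key i f hf]; omega,
        if_pos h₁, if_pos (by omega), pairSign, if_neg hr, hx, hy, hx', hy']
      norm_num
    · rw [if_neg h₁, zero_add]
      split_ifs with h₂ h₃
      · rw [hg.sideSum_eq_zero hw hs hσ fun i f hf => by rw [key i f hf]; omega, mul_zero]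
      · obtain ⟨c, hc⟩ := exists_row ty (w := w) (k := j - 3 * w) (by omega)
        rw [hg.sideSum_eq_single hw hs hσ hc fun i f hf => by rw [key i f hf]; omega,
          pairSign_earlier hc hg hw hodd (by omega) hj, if_pos (by omega)]
      · obtain ⟨c, hc⟩ := exists_row ty (w := w) (k := j - 3 * w) (by omega)
        rw [hg.sideSum_eq_single hw hs hσ hc fun i f hf => by rw [key i f hf]; omega,
          pairSign_earlier hc hg hw hodd (by omega) hj, if_neg (by omega), neg_one_pow_eq_ite,
          neg_one_pow_eq_ite]
        split_ifs <;> first | rfl | omega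

theorem sideSum_far_pos (hw : 0 < w) (hs : s = 1 ∨ s = -1) (hj : 8 * w ≤ j)
    (hj' : j < numFolds ty w) : sideSum ty w s j 1 = 0 := by
  obtain ⟨g, hg⟩ := exists_row ty hj'
  exact hg.sideSum_eq_zero hw hs (.inl rfl) fun i f hf => hf.not_meets_top_pos hg hj hw

theorem Row.exists_top (ty : BandType) (w : ℕ) : ∃ f, Row ty w (8 * w) f ∧ f.dx = 1 ∧ f.dy = 0 := by
  have hn := numFolds_bounds ty w
  obtain ⟨f, hf⟩ := exists_row ty (w := w) (k := 8 * w) (by omega)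
  rcases hf.dir_stair le_rfl with h | h
  · exact ⟨f, hf, h.2⟩
  · omega

theorem Row.exists_up (ty : BandType) {w k : ℕ} (h : k + 1 = numFolds ty w) :
    ∃ f, Row ty w k f ∧ f.dx = 0 ∧ f.dy = 1 := by
  obtain ⟨f, hf⟩ := exists_row ty (w := w) (k := k) (by omega)
  exact ⟨f, hf, hf.dir_up h⟩

theorem rank_far (h : 8 * w < k) : rank ty w k = k + 1 - numFolds ty w := by
  rw [rank, if_neg (by omega), if_neg (by omega)]

theorem rank_stair_pos (hw : 0 < w) (h : k ≤ 8 * w) : 0 < rank ty w k := by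
  unfold rank; split_ifs <;> omega

/-- For `s = 1` piece `8 * w + 1` lies below both edges that cross its inner side, and for `s = -1`
above both; they cross it in opposite directions, so the signs cancel. -/
theorem sideSum_first (hw : 0 < w) (hs : s = 1 ∨ s = -1) :
    sideSum ty w s (8 * w + 1) (-1) = 0 := by
  have hn := numFolds_bounds ty w
  obtain ⟨c, hc, cx, cy⟩ := Row.exists_top ty w
  have h₁ : rank ty w (8 * w + 1) < rank ty w (8 * w) := by
    have := rank_stair_pos (ty := ty) hw (le_refl (8 * w))
    rw [rank_far (by omega)]
    push_cast
    omega
  have h₂ : rank ty w (8 * w + 1) < rank ty w (8 * w + 2) := by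
    rw [rank_far (by omega), rank_far (by omega)]
    push_cast
    omega
  cases ty with
  | mobius =>
    obtain ⟨d, hd, dx, dy⟩ := Row.exists_up .mobius (w := w) (k := 8 * w + 2) rfl
    have hg : Row .mobius w (8 * w + 1) _ := .slanted rfl
    rw [hg.sideSum_eq_add hw hs (.inr rfl) hc hd (by omega) fun i f hf => hf.meets_first_neg hg hw,
      pairSign, pairSign, if_pos h₁, if_pos h₂, cx, cy, dx, dy, sign_neg (by norm_num),
      sign_pos (by norm_num)]
    simp
  | annulus =>
    have hd : Row .annulus w (8 * w + 2) _ := .left rfl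
    have hg : Row .annulus w (8 * w + 1) _ := .down rfl
    rw [hg.sideSum_eq_add hw hs (.inr rfl) hc hd (by omega) fun i f hf => hf.meets_first_neg hg hw,
      pairSign, pairSign, if_pos h₁, if_pos h₂, cx, cy, sign_neg (by norm_num),
      sign_pos (by norm_num)]
    simp

/-- The preceding edge and staircase edge `3w - 1` cross this side in opposite directions and on
opposite layers, so both signs equal `s`. -/
theorem sideSum_up (hw : 0 < w) (hodd : w % 2 = 1) (hs : s = 1 ∨ s = -1)
    (hj : j + 1 = numFolds ty w) : sideSum ty w s j (-1) = s * 2 := by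
  have hn := numFolds_bounds ty w
  obtain ⟨g, hg, gx, gy⟩ := Row.exists_up ty hj
  obtain ⟨c, hc⟩ := exists_row ty (w := w) (k := j - 1) (by omega)
  obtain ⟨d, hd⟩ := exists_row ty (w := w) (k := 3 * w - 1) (by omega)
  have hc' : c.dx < 0 := by
    generalize hl : j - 1 = l at hc
    cases hc with
    | slanted => norm_num
    | left => norm_num
    | down h => subst h; simp only [numFolds] at hj; omega
    | _ => omega
  have h₁ : ¬ rank ty w j < rank ty w (j - 1) := by
    rw [rank_far (by omega), rank_far (by omega)]
    omega
  have h₂ : rank ty w j < rank ty w (3 * w - 1) := by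
    have := rank_stair_pos (ty := ty) hw (show 3 * w - 1 ≤ 8 * w by omega)
    rw [rank_far (by omega)]
    omega
  obtain ⟨-, dx, dy⟩ : (3 * w - 1) % 2 = 0 ∧ d.dx = 1 ∧ d.dy = 0 := by
    rcases hd.dir_stair (by omega) with h | h <;> omega
  rw [hg.sideSum_eq_add hw hs (.inr rfl) hc hd (by omega) fun i f hf => by
      rw [hf.meets_up_neg hg hw hodd hj]; omega,
    pairSign, pairSign, if_neg h₁, if_pos h₂, gx, gy, dx, dy, mul_zero, mul_one, sub_zero,
    sign_neg hc', mul_one, mul_zero, sub_zero, sign_pos one_pos]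
  rfl

theorem sum_sideSum_same (hw : 0 < w) (hodd : w % 2 = 1) (hs : s = 1 ∨ s = -1) :
    ∑ j ∈ Finset.range (8 * w + 1), sideSum ty w s j ((-1) ^ j) = s * (w - 1) := by
  rw [Finset.sum_congr rfl fun j hj =>
    sideSum_same hw hodd hs (Nat.lt_succ_iff.1 (Finset.mem_range.1 hj)), ← Finset.mul_sum,
    Finset.range_eq_Ico, ← Finset.sum_Ico_consecutive _ (Nat.zero_le w) (by omega),
    ← Finset.sum_Ico_consecutive _ (show w ≤ 5 * w + 1 by omega) (by omega)]
  have h₁ : ∀ j ∈ Finset.Ico 0 w,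
      (if j ≤ 5 * w then (if j < w then 1 else (-1) ^ j) else 0 : ℤ) = 1 := by
    intro j hj
    rw [Finset.mem_Ico] at hj
    rw [if_pos (by omega), if_pos hj.2]
  have h₂ : ∀ j ∈ Finset.Ico w (5 * w + 1),
      (if j ≤ 5 * w then (if j < w then 1 else (-1) ^ j) else 0 : ℤ) = (-1) ^ j := by
    intro j hj
    rw [Finset.mem_Ico] at hj
    rw [if_pos (by omega), if_neg (by omega)]
  have h₃ : ∀ j ∈ Finset.Ico (5 * w + 1) (8 * w + 1),
      (if j ≤ 5 * w then (if j < w then 1 else (-1) ^ j) else 0 : ℤ) = 0 := by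
    intro j hj
    rw [Finset.mem_Ico] at hj
    rw [if_neg (by omega)]
  rw [Finset.sum_congr rfl h₁, Finset.sum_congr rfl h₂, Finset.sum_congr rfl h₃,
    sum_neg_one_pow_Ico hodd (by omega), if_neg (by omega)]
  simp [sub_eq_add_neg]

/-- The extra crossings `+1` and `-1` cancel, the wrapping gives `w`, and the alternating sum from
`4w` to `8w` leaves `-1`. -/
theorem sum_sideSum_opposite (hw : 0 < w) (hodd : w % 2 = 1) (hs : s = 1 ∨ s = -1) :
    ∑ j ∈ Finset.range (8 * w + 1), sideSum ty w s j (-(-1) ^ j) = s * (w - 1) := by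
  rw [Finset.sum_congr rfl fun j hj =>
    sideSum_opposite hw hodd hs (Nat.lt_succ_iff.1 (Finset.mem_range.1 hj)), ← Finset.mul_sum,
    Finset.sum_add_distrib, Finset.sum_add_distrib, Finset.sum_ite_eq', Finset.sum_ite_eq',
    if_pos (Finset.mem_range.2 (by omega)), if_pos (Finset.mem_range.2 (by omega)),
    Finset.range_eq_Ico, ← Finset.sum_Ico_consecutive _ (Nat.zero_le (3 * w)) (by omega),
    ← Finset.sum_Ico_consecutive _ (show 3 * w ≤ 4 * w by omega) (by omega)]
  have h₁ : ∀ j ∈ Finset.Ico 0 (3 * w),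
      (if j < 3 * w then 0 else if j < 4 * w then 1 else -(-1) ^ j : ℤ) = 0 := by
    intro j hj
    rw [if_pos (Finset.mem_Ico.1 hj).2]
  have h₂ : ∀ j ∈ Finset.Ico (3 * w) (4 * w),
      (if j < 3 * w then 0 else if j < 4 * w then 1 else -(-1) ^ j : ℤ) = 1 := by
    intro j hj
    rw [Finset.mem_Ico] at hj
    rw [if_neg (by omega), if_pos hj.2]
  have h₃ : ∀ j ∈ Finset.Ico (4 * w) (8 * w + 1),
      (if j < 3 * w then 0 else if j < 4 * w then 1 else -(-1) ^ j : ℤ) = -(-1) ^ j := by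
    intro j hj
    rw [Finset.mem_Ico] at hj
    rw [if_neg (by omega), if_neg (by omega)]
  rw [Finset.sum_congr rfl h₁, Finset.sum_congr rfl h₂, Finset.sum_congr rfl h₃,
    Finset.sum_neg_distrib, Finset.sum_Ico_eq_sub _ (show 4 * w ≤ 8 * w + 1 by omega),
    neg_one_geom_sum, neg_one_geom_sum, if_neg (by rw [Nat.even_iff]; omega), if_pos (by rw [Nat.even_iff]; omega)]
  simp [show 4 * w - 3 * w = w by omega, sub_eq_add_neg]

theorem ribbonLk_eq_sum : (ribbon ty w s).ribbonLk =
    1 / 2 * ((∑ k ∈ Finset.range (ribbon ty w s).boundarySides,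
      sideSum ty w s k ((-1) ^ k) : ℤ) : ℚ) := by
  rw [RibbonData.ribbonLk, Finset.sum_comm]
  push_cast [sideSum]
  rfl

theorem sideSum_add_n (k : ℕ) (σ : ℤ) :
    sideSum ty w s ((ribbon ty w s).n + k) σ = sideSum ty w s k σ := by
  unfold sideSum
  push_cast
  simp

/-- One lap of the boundary gives `s * (w - 1)` on the staircase. The inner side of the last piece
adds `2 * s` and is met once in all, during the first lap for the annulus and during the second for
the Möbius band. The crossing sums are thus `s * (w + 1)` and `2 * s * w`. -/
theorem ribbonLk_eq (hw : 0 < w) (hodd : w % 2 = 1) (hs : s = 1 ∨ s = -1) :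
    (ribbon ty w s).ribbonLk = (ribbon ty w s).foldCount := by
  rw [RibbonData.foldCount, ribbon_bandType, ribbon_foldSum hw hodd hs, ribbonLk_eq_sum,
    RibbonData.boundarySides]
  cases ty with
  | annulus =>
    have h : ¬ Odd (ribbon .annulus w s).n := by
      rw [ribbon_n, numFolds, Nat.odd_iff]; omega
    rw [if_neg h, ribbon_n, numFolds]
    have e₁ : (-1 : ℤ) ^ (8 * w + 1) = -1 := by rw [neg_one_pow_eq_ite, if_neg (by omega)]
    have e₂ : (-1 : ℤ) ^ (8 * w + 2) = 1 := by rw [neg_one_pow_eq_ite, if_pos (by omega)]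
    have e₃ : (-1 : ℤ) ^ (8 * w + 3) = -1 := by rw [neg_one_pow_eq_ite, if_neg (by omega)]
    rw [Finset.sum_range_succ, Finset.sum_range_succ, Finset.sum_range_succ,
      sum_sideSum_same hw hodd hs, e₁, e₂, e₃, sideSum_first hw hs,
      sideSum_far_pos hw hs (by omega) (by simp [numFolds]), sideSum_up hw hodd hs rfl]
    push_cast
    ring
  | mobius =>
    have h : Odd (ribbon .mobius w s).n := by
      rw [ribbon_n, numFolds, Nat.odd_iff]; omega
    have e₁ : (-1 : ℤ) ^ (8 * w + 1) = -1 := by rw [neg_one_pow_eq_ite, if_neg (by omega)]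
    have e₂ : (-1 : ℤ) ^ (8 * w + 2) = 1 := by rw [neg_one_pow_eq_ite, if_pos (by omega)]
    -- In the second lap around a Möbius band every side is replaced by the opposite one, as `n` is
    -- odd.
    have h₂ : ∑ k ∈ Finset.range (ribbon .mobius w s).n,
        sideSum .mobius w s ((ribbon .mobius w s).n + k) ((-1) ^ ((ribbon .mobius w s).n + k)) =
        ∑ k ∈ Finset.range (ribbon .mobius w s).n, sideSum .mobius w s k (-(-1) ^ k) := by
      refine Finset.sum_congr rfl fun k _ => ?_
      rw [sideSum_add_n, pow_add, h.neg_one_pow, neg_one_mul]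
    rw [if_pos h, two_mul, Finset.sum_range_add, h₂, ribbon_n, numFolds]
    rw [Finset.sum_range_succ _ (8 * w + 2), Finset.sum_range_succ _ (8 * w + 1),
      Finset.sum_range_succ _ (8 * w + 2), Finset.sum_range_succ _ (8 * w + 1),
      sum_sideSum_same hw hodd hs, sum_sideSum_opposite hw hodd hs, e₁, e₂, neg_neg,
      sideSum_first hw hs, sideSum_far_pos hw hs (by omega) (by simp [numFolds]),
      sideSum_far_pos hw hs (by omega) (by simp [numFolds]), sideSum_up hw hodd hs rfl]
    push_cast
    ring

end

end FoldedRibbon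

/-! ### The centreline is an unknot. -/

namespace FoldedRibbon

/-- The sides of a bounded convex polygon with inner points form a closed curve that is unknotted
in the plane. -/
theorem exists_homeomorph_polygon {ι : Type*} [Finite ι] (a b c : ι → ℝ)
    (h : ∀ i, a i ≠ 0 ∨ b i ≠ 0) (r : ℝ)
    (hr : ∀ z : ℂ, (∀ i, a i * z.re + b i * z.im ≤ c i) → |z.re| ≤ r ∧ |z.im| ≤ r)
    (z₀ : ℂ) (hz : ∀ i, a i * z₀.re + b i * z₀.im < c i) :
    ∃ φ : ℂ ≃ₜ ℂ, φ '' {z | (∀ i, a i * z.re + b i * z.im ≤ c i) ∧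
      ∃ i, a i * z.re + b i * z.im = c i} = {z | ‖z‖ = 1} := by
  let l (i : ι) : ℂ →L[ℝ] ℝ := a i • Complex.reCLM + b i • Complex.imCLM
  have hl : ∀ i z, l i z = a i * z.re + b i * z.im := fun i z => by simp [l]
  have hsurj : ∀ i, Function.Surjective (l i) := fun i => by
    apply LinearMap.surjective (f := (l i).toLinearMap)
    intro h0
    have h1 : l i 1 = 0 := LinearMap.congr_fun h0 1
    have h2 : l i Complex.I = 0 := LinearMap.congr_fun h0 Complex.I
    rw [hl] at h1 h2
    rcases h i with h | h
    · exact h (by simpa using h1)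
    · exact h (by simpa using h2)
  let B : Set ℂ := ⋂ i, l i ⁻¹' Set.Iic (c i)
  have hB : ∀ z, z ∈ B ↔ ∀ i, a i * z.re + b i * z.im ≤ c i := fun z => by
    simp [B, hl]
  have hclosed : IsClosed B := isClosed_iInter fun i => isClosed_Iic.preimage (l i).continuous
  have hint : ∀ z, z ∈ interior B ↔ ∀ i, a i * z.re + b i * z.im < c i := fun z => by
    rw [interior_iInter_of_finite]
    simp [(l _).interior_preimage (hsurj _), hl]
  have hconv : Convex ℝ B := convex_iInter fun i =>
    (convex_Iic (c i)).linear_preimage (l i).toLinearMap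
  have hbdd : Bornology.IsBounded B := by
    refine (Metric.isBounded_closedBall (x := (0 : ℂ)) (r := 2 * r)).subset fun z hz => ?_
    obtain ⟨h1, h2⟩ := hr z ((hB z).1 hz)
    rw [mem_closedBall_zero_iff]
    exact (Complex.norm_le_abs_re_add_abs_im z).trans (by linarith)
  -- A bounded convex set with inner points is carried to the unit ball, frontier to frontier.
  obtain ⟨φ, -, -, hφ⟩ := exists_homeomorph_image_interior_closure_frontier_eq_unitBall hconv
    ⟨z₀, (hint z₀).2 hz⟩ hbdd
  refine ⟨φ, ?_⟩
  have hf : frontier B = {z | (∀ i, a i * z.re + b i * z.im ≤ c i) ∧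
      ∃ i, a i * z.re + b i * z.im = c i} := by
    ext z
    rw [hclosed.frontier_eq, Set.mem_sdiff, hB, hint, Set.mem_ofPred_eq]
    refine and_congr_right fun hz => ?_
    push Not
    exact exists_congr fun i => ⟨fun h => le_antisymm (hz i) h, fun h => h.ge⟩
  rw [← hf, hφ]
  ext z
  simp

/-- The distance from the multiples of `4` on the interval from `0` to `l`. -/
noncomputable def zigzag (l u : ℝ) : ℝ := ‖((max 0 (min u l) : ℝ) : AddCircle (4 : ℝ))‖

theorem continuous_zigzag (l : ℝ) : Continuous (zigzag l) := by
  unfold zigzag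
  exact continuous_norm.comp ((AddCircle.continuous_mk' 4).comp (by fun_prop))

theorem zigzag_eq {l u : ℝ} (h0 : 0 ≤ u) (hl : u ≤ l) (a : ℤ) (h : |u - 4 * a| ≤ 2) :
    zigzag l u = |u - 4 * a| := by
  rw [zigzag, min_eq_left hl, max_eq_right h0]
  have : ((u : ℝ) : AddCircle (4 : ℝ)) = ((u - 4 * a : ℝ) : AddCircle (4 : ℝ)) := by
    rw [← sub_eq_zero, ← AddCircle.coe_sub, AddCircle.coe_eq_zero_iff]
    exact ⟨a, by simp; ring⟩
  rw [this, (AddCircle.norm_coe_eq_abs_iff (4 : ℝ) (by norm_num)).2]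
  rw [abs_of_pos (by norm_num : (0 : ℝ) < 4)]
  linarith

theorem zigzag_of_nonpos {l u : ℝ} (hl : 0 ≤ l) (hu : u ≤ 0) : zigzag l u = 0 := by
  rw [zigzag, min_eq_left (hu.trans hl), max_eq_left hu]
  simp

theorem zigzag_of_ge {u : ℝ} (a : ℕ) (hu : 4 * a ≤ u) : zigzag (4 * a) u = 0 := by
  have := zigzag_eq (l := 4 * a) (u := 4 * a) (by positivity) le_rfl a (by simp)
  rw [zigzag, min_eq_right hu, ← min_self (4 * a : ℝ)]
  simpa [zigzag] using this

/-- The amount by which `straighten l` moves a point. -/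
noncomputable def shift (l u y : ℝ) : ℝ := zigzag l u * max 0 (1 - y / l) / 2

theorem continuous_mk_shift (l : ℝ) (ε : ℝ) : Continuous fun q : ℂ × ℝ =>
    ((⟨q.1.re - ε * shift l (q.1.re + q.1.im) q.2, q.1.im + ε * shift l (q.1.re + q.1.im) q.2⟩, q.2) :
      ℂ × ℝ) := by
  have h₁ : Continuous fun q : ℂ × ℝ => zigzag l (q.1.re + q.1.im) :=
    (continuous_zigzag l).comp (by fun_prop)
  have h₂ : Continuous fun q : ℂ × ℝ => ε * shift l (q.1.re + q.1.im) q.2 := by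
    unfold shift
    fun_prop
  exact (Complex.equivRealProdCLM.symm.continuous.comp
    ((by fun_prop : Continuous fun q : ℂ × ℝ => q.1.re - ε * shift l (q.1.re + q.1.im) q.2).prodMk
      (by fun_prop))).prodMk continuous_snd

/-- A homeomorphism of space which straightens a staircase at height `0`. -/
noncomputable def straighten (l : ℝ) : (ℂ × ℝ) ≃ₜ (ℂ × ℝ) where
  toFun q := (⟨q.1.re - 1 * shift l (q.1.re + q.1.im) q.2,
    q.1.im + 1 * shift l (q.1.re + q.1.im) q.2⟩, q.2)
  invFun q := (⟨q.1.re - (-1) * shift l (q.1.re + q.1.im) q.2,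
    q.1.im + (-1) * shift l (q.1.re + q.1.im) q.2⟩, q.2)
  left_inv q := by
    dsimp only
    rw [show ∀ x y z : ℝ, x - z + (y + z) = x + y by intros; ring]
    simp
  right_inv q := by
    dsimp only
    rw [show ∀ x y z : ℝ, x - z + (y + z) = x + y by intros; ring]
    simp
  continuous_toFun := continuous_mk_shift l 1
  continuous_invFun := continuous_mk_shift l (-1)

/-- A homeomorphism of space which moves the plane of all points over `z` at height
`z.re - z.im` to height `0`. -/
noncomputable def lower : (ℂ × ℝ) ≃ₜ (ℂ × ℝ) where
  toFun q := (q.1, q.2 - (q.1.re - q.1.im))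
  invFun q := (q.1, q.2 + (q.1.re - q.1.im))
  left_inv q := by simp
  right_inv q := by simp
  continuous_toFun := by fun_prop
  continuous_invFun := by fun_prop

theorem lower_straighten {l x y z : ℝ} :
    lower (straighten l (⟨x, y⟩, z)) =
      (⟨x - shift l (x + y) z, y + shift l (x + y) z⟩, z - (x - y) + 2 * shift l (x + y) z) := by
  simp [lower, straighten]
  ring

section

variable {ty : BandType} {w i j k : ℕ} {s : ℤ} {f g : Frame}

/-- Coefficients of the linear inequalities that describe the polygon obtained by straightening the
staircase. -/
noncomputable def coeff (ty : BandType) (w : ℕ) : Fin 5 → ℝ × ℝ × ℝ :=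
  match ty with
  -- The Möbius outline has only four sides; the last inequality is repeated so that both types
  -- share the index set.
  | .mobius => ![(-1, 0, 0), (0, 1, 8 * w), (-1, 1, 0), (3, -4, 64 * w), (3, -4, 64 * w)]
  | .annulus => ![(-1, 0, 0), (0, 1, 8 * w), (-1, 1, 0), (1, 0, 32 * w), (0, -1, 16 * w)]

/-- The polygon obtained by straightening the staircase. -/
def outline (ty : BandType) (w : ℕ) : Set ℂ :=
  {z | (∀ i, (coeff ty w i).1 * z.re + (coeff ty w i).2.1 * z.im ≤ (coeff ty w i).2.2) ∧
    ∃ i, (coeff ty w i).1 * z.re + (coeff ty w i).2.1 * z.im = (coeff ty w i).2.2}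

theorem exists_homeomorph_outline (ty : BandType) (hw : 0 < w) :
    ∃ φ : ℂ ≃ₜ ℂ, φ '' outline ty w = {z | ‖z‖ = 1} := by
  have hw' : (0 : ℝ) < w := by exact_mod_cast hw
  refine exists_homeomorph_polygon (fun i => (coeff ty w i).1) (fun i => (coeff ty w i).2.1)
    (fun i => (coeff ty w i).2.2) ?_ (100 * w) ?_ ⟨10 * w, -w⟩ ?_
  · intro i
    cases ty <;> fin_cases i <;> simp [coeff]
  · intro z hz
    have h₀ := hz 0
    have h₁ := hz 1
    have h₂ := hz 2
    have h₃ := hz 3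
    have h₄ := hz 4
    cases ty <;> simp [coeff] at h₀ h₁ h₂ h₃ h₄ <;> rw [abs_le, abs_le] <;>
      refine ⟨⟨?_, ?_⟩, ?_, ?_⟩ <;> linarith
  · intro i
    cases ty <;> fin_cases i <;> simp [coeff] <;> linarith

theorem Row.mem_outline (h : Row ty w k f) (hw : 0 < w) (hk : 8 * w ≤ k) {t : ℝ} (h0 : 0 ≤ t)
    (h1 : t ≤ f.len) : (⟨f.x + t * f.dx, f.y + t * f.dy⟩ : ℂ) ∈ outline ty w := by
  have hw' : (0 : ℝ) < w := by exact_mod_cast hw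
  have hn := numFolds_bounds ty w
  cases h with
  | even => omega
  | odd => omega
  | top =>
    exact ⟨fun i => by cases ty <;> fin_cases i <;> simp [coeff] <;> linarith, 1,
      by cases ty <;> simp [coeff]⟩
  | slanted h =>
    subst h
    exact ⟨fun i => by fin_cases i <;> simp [coeff] <;> linarith, 3, by simp [coeff]; ring⟩
  | down h =>
    subst h
    exact ⟨fun i => by fin_cases i <;> simp [coeff] <;> linarith, 3, by simp [coeff]⟩
  | left h =>
    subst h
    exact ⟨fun i => by fin_cases i <;> simp [coeff] <;> linarith, 4, by simp [coeff]⟩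
  | up =>
    exact ⟨fun i => by cases ty <;> fin_cases i <;> simp [coeff] <;> linarith, 0,
      by cases ty <;> simp [coeff]⟩

theorem mem_outline_diag (hw : 0 < w) {t : ℝ} (h0 : 0 ≤ t) (h1 : t ≤ 8 * w) :
    (⟨t, t⟩ : ℂ) ∈ outline ty w := by
  have hw' : (0 : ℝ) < w := by exact_mod_cast hw
  exact ⟨fun i => by cases ty <;> fin_cases i <;> simp [coeff] <;> linarith, 2,
    by cases ty <;> simp [coeff]⟩

theorem exists_of_mem_outline (hw : 0 < w) {z : ℂ} (hz : z ∈ outline ty w) :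
    (∃ t : ℝ, 0 ≤ t ∧ t ≤ 8 * w ∧ z = ⟨t, t⟩) ∨ ∃ k f t, Row ty w k f ∧ 8 * w ≤ k ∧ 0 ≤ t ∧ t ≤ f.len ∧
      z = ⟨f.x + t * f.dx, f.y + t * f.dy⟩ := by
  have hw' : (0 : ℝ) < w := by exact_mod_cast hw
  have hn := numFolds_bounds ty w
  obtain ⟨hz, hz'⟩ := hz
  have h₀ := hz 0
  have h₁ := hz 1
  have h₂ := hz 2
  have h₃ := hz 3
  have h₄ := hz 4
  clear hz
  cases ty with
  | mobius =>
    have hu : Row .mobius w (8 * w + 2) _ := .up _ rfl (-4 / 5) (-3 / 5) (3 / 2) (by norm_num)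
      (by norm_num) (by simp) (by simp)
    have ht : Row .mobius w (8 * w) _ := .top 1 (by norm_num) (by norm_num) (by simp) (by simp)
    have hs : Row .mobius w (8 * w + 1) _ := .slanted rfl
    obtain ⟨i, hi⟩ := hz'
    fin_cases i <;> simp [coeff] at h₀ h₁ h₂ h₃ h₄ hi
    · exact .inr ⟨_, _, z.im + 16 * w, hu, by omega, by linarith, by dsimp only; linarith,
        Complex.ext (by simp [hi]) (by simp)⟩
    · exact .inr ⟨_, _, z.re - 8 * w, ht, by omega, by linarith, by dsimp only; linarith,
        Complex.ext (by simp) (by simp [hi])⟩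
    · exact .inl ⟨z.re, by linarith, by linarith, Complex.ext rfl (by dsimp only; linarith)⟩
    · exact .inr ⟨_, _, 5 / 4 * (32 * w - z.re), hs, by omega, by linarith,
        by dsimp only; linarith, Complex.ext (by dsimp only; ring) (by dsimp only; linarith)⟩
    · exact .inr ⟨_, _, 5 / 4 * (32 * w - z.re), hs, by omega, by linarith,
        by dsimp only; linarith, Complex.ext (by dsimp only; ring) (by dsimp only; linarith)⟩
  | annulus =>
    have hu : Row .annulus w (8 * w + 3) _ := .up _ rfl (-1) 0 3 (by norm_num)
      (by norm_num) (by simp) (by simp)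
    have ht : Row .annulus w (8 * w) _ := .top 3 (by norm_num) (by norm_num) (by simp) (by simp)
    have hd : Row .annulus w (8 * w + 1) _ := .down rfl
    have hl : Row .annulus w (8 * w + 2) _ := .left rfl
    obtain ⟨i, hi⟩ := hz'
    fin_cases i <;> simp [coeff] at h₀ h₁ h₂ h₃ h₄ hi
    · exact .inr ⟨_, _, z.im + 16 * w, hu, by omega, by linarith, by dsimp only; linarith,
        Complex.ext (by simp [hi]) (by simp)⟩
    · exact .inr ⟨_, _, z.re - 8 * w, ht, by omega, by linarith, by dsimp only; linarith,
        Complex.ext (by simp) (by simp [hi])⟩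
    · exact .inl ⟨z.re, by linarith, by linarith, Complex.ext rfl (by dsimp only; linarith)⟩
    · exact .inr ⟨_, _, 8 * w - z.im, hd, by omega, by linarith,
        by dsimp only; linarith, Complex.ext (by simp [hi]) (by simp)⟩
    · exact .inr ⟨_, _, 32 * w - z.re, hl, by omega, by linarith,
        by dsimp only; linarith, Complex.ext (by simp) (by dsimp only; linarith)⟩

/-- Heights over the centreline. -/
noncomputable def height (ty : BandType) (w : ℕ) (s : ℤ) (i : ZMod (ribbon ty w s).n) (t : ℝ) : ℝ :=
  -- The two formulas agree where they meet, at vertices 0 and `8 * w`, since both lie on the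
  -- diagonal.
  if i.val < 8 * w then 0
  else ((ribbon ty w s).point i t).re - ((ribbon ty w s).point i t).im

theorem Row.point_eq (h : Row ty w k f) (t : ℝ) :
    (ribbon ty w s).point (k : ZMod (ribbon ty w s).n) t =
      ⟨f.x + t * f.len * f.dx, f.y + t * f.len * f.dy⟩ := by
  rw [RibbonData.point, h.v_eq, h.v_succ]
  apply Complex.ext <;> simp <;> ring

theorem Row.height_eq (h : Row ty w k f) (t : ℝ) :
    height ty w s (k : ZMod (ribbon ty w s).n) t = if k < 8 * w then 0 else
      f.x + t * f.len * f.dx - (f.y + t * f.len * f.dy) := by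
  rw [height, val_cast h.lt, h.point_eq]

/-- Different edges do not meet in inner points, so the layers impose no condition and only
continuity has content. -/
theorem ribbon_isLift (hw : 0 < w) : (ribbon ty w s).IsLift (height ty w s) := by
  have hn := numFolds_bounds ty w
  refine ⟨fun i => ?_, fun i => ?_, fun i j hij a ha b hb h => ?_⟩
  · obtain ⟨k, f, hk, rfl⟩ := exists_eq_cast i
    rw [funext (hk.height_eq (s := s))]
    split_ifs <;> fun_prop
  · obtain ⟨k, f, hk, rfl⟩ := exists_eq_cast i
    rcases (Nat.succ_le_of_lt hk.lt).lt_or_eq with h | h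
    · obtain ⟨g, hg⟩ := exists_row ty h
      have hv := hk.vert_succ
      rw [hg.vert_eq, Complex.ext_iff] at hv
      obtain ⟨vx, vy⟩ := hv
      dsimp only at vx vy
      rw [hk.height_eq, show (k : ZMod (ribbon ty w s).n) + 1 = (k + 1 : ℕ) by push_cast; rfl,
        hg.height_eq]
      split_ifs with h₁ h₂ h₂
      · rfl
      · have hg' := hg.vert_eq
        rw [show k.succ = 8 * w by omega, vert_top, Complex.ext_iff] at hg'
        obtain ⟨gx, gy⟩ := hg'
        dsimp only at gx gy
        rw [← gx, ← gy]
        ring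
      · omega
      · rw [vx, vy]; ring
    · rw [cast_last h, ← Nat.cast_zero, (Row.even (ty := ty) 0 (by omega)).height_eq,
        hk.height_eq, if_neg (by omega), if_pos (by omega)]
      have hv := hk.vert_succ
      rw [show k + 1 = numFolds ty w from h, vert_numFolds, Complex.ext_iff] at hv
      obtain ⟨vx, vy⟩ := hv
      dsimp only at vx vy
      linarith
  · exfalso
    obtain ⟨i, f, hi, rfl⟩ := exists_eq_cast i
    obtain ⟨j, g, hj, rfl⟩ := exists_eq_cast j
    have hij' : i ≠ j := fun e => hij (by rw [e])
    rw [hi.point_eq, hj.point_eq, Complex.ext_iff] at h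
    obtain ⟨hx, hy⟩ := h
    have hf := hi.len_pos hw
    have hg := hj.len_pos hw
    have a0 := mul_pos ha.1 hf
    have b0 := mul_pos hb.1 hg
    have a1 : a * f.len < f.len := by nlinarith [ha.2]
    have b1 : b * g.len < g.len := by nlinarith [hb.2]
    rcases hij'.lt_or_gt with h | h
    · rcases Row.edges_meet hi hj hw h a0.le a1.le b0.le b1.le hx hy with h | h
      · exact a1.ne h.2.1
      · exact a0.ne' h.2.2.1
    · rcases Row.edges_meet hj hi hw h b0.le b1.le a0.le a1.le hx.symm hy.symm with h | h
      · exact b1.ne h.2.1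
      · exact b0.ne' h.2.2.1

theorem shift_zero {l u : ℝ} : shift l u 0 = zigzag l u / 2 := by
  simp [shift]

/-- The shear leaves the closing polygon fixed: on the top and the ascending edge `x + y` is outside
the range of the zigzag, and on the others the height `x - y` is at least `16 * w`, where the
damping factor is 0. -/
theorem Row.straighten_far (h : Row ty w k f) (hw : 0 < w) (hk : 8 * w ≤ k) {t : ℝ} (h0 : 0 ≤ t)
    (h1 : t ≤ f.len) :
    shift (16 * w) (f.x + t * f.dx + (f.y + t * f.dy)) (f.x + t * f.dx - (f.y + t * f.dy)) = 0 := by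
  have hw' : (0 : ℝ) < w := by exact_mod_cast hw
  have hz : ∀ u y : ℝ, 16 * w ≤ y → shift (16 * w) u y = 0 := fun u y hy => by
    have : 1 - y / (16 * w) ≤ 0 := by
      rw [sub_nonpos, le_div_iff₀ (by positivity)]
      linarith
    rw [shift, max_eq_left this, mul_zero, zero_div]
  cases h with
  | even => omega
  | odd => omega
  | top =>
    have := zigzag_of_ge (u := 8 * w + t * 1 + (8 * w + t * 0)) (4 * w) (by push_cast; linarith)
    push_cast at this
    rw [shift, show (16 : ℝ) * w = 4 * (4 * w) by ring, this]
    simp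
  | up => rw [shift, zigzag_of_nonpos (by positivity) (by linarith)]; simp
  | _ => exact hz _ _ (by linarith)

/-- On the staircase `x - y` is the zigzag function of `x + y`, of period 4. Moving by half of it
along `(-1, 1)` brings each point to the diagonal and keeps `x + y`. -/
theorem Row.straighten_stair (h : Row ty w k f) (hk : k < 8 * w) {t : ℝ} (h0 : 0 ≤ t)
    (h1 : t ≤ 2) :
    2 * shift (16 * w) (f.x + t * f.dx + (f.y + t * f.dy)) 0 =
      f.x + t * f.dx - (f.y + t * f.dy) ∧ f.x + t * f.dx + (f.y + t * f.dy) = 2 * k + t := by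
  have hn := numFolds_bounds ty w
  rw [shift_zero]
  cases h with
  | even a h =>
    have ha : (a : ℝ) + 1 ≤ 4 * w := by exact_mod_cast h
    have e : 2 * (a : ℝ) + t * 1 + (2 * a + t * 0) - 4 * (a : ℤ) = t := by push_cast; ring
    have := zigzag_eq (l := 16 * w) (u := 2 * a + t * 1 + (2 * a + t * 0)) (by positivity)
      (by linarith) a (by rw [e, abs_le]; constructor <;> linarith)
    rw [this, e, abs_of_nonneg h0]
    push_cast
    constructor <;> ring
  | odd a h =>
    have ha : (a : ℝ) + 1 ≤ 4 * w := by exact_mod_cast h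
    have e : 2 * (a : ℝ) + 2 + t * 0 + (2 * a + t * 1) - 4 * ((a + 1 : ℤ) : ℝ) = -(2 - t) := by
      push_cast; ring
    have := zigzag_eq (l := 16 * w) (u := 2 * a + 2 + t * 0 + (2 * a + t * 1)) (by positivity)
      (by linarith) (a + 1) (by rw [e, abs_le]; constructor <;> linarith)
    rw [this, e, abs_neg, abs_of_nonneg (by linarith)]
    push_cast
    constructor <;> ring
  | _ => omega

theorem Row.len_stair (h : Row ty w k f) (hk : k < 8 * w) : f.len = 2 := by
  have hn := numFolds_bounds ty w
  cases h with
  | even => rfl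
  | odd => rfl
  | _ => omega

/-- After the shear, height equals `x - y` on the whole curve: both vanish on the straightened
staircase, and on the rest this was the choice of heights. `lower` then flattens it into the plane.
-/
theorem image_liftedCurve (hw : 0 < w) :
    (straighten (16 * w)).trans lower '' (ribbon ty w s).liftedCurve (height ty w s) =
      {q | q.1 ∈ outline ty w ∧ q.2 = 0} := by
  have hw' : (0 : ℝ) < w := by exact_mod_cast hw
  have hstair : ∀ {k f t}, Row ty w k f → k < 8 * w → 0 ≤ t → t ≤ 2 →
      lower (straighten (16 * w) (⟨f.x + t * f.dx, f.y + t * f.dy⟩, 0)) =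
        (⟨k + t / 2, k + t / 2⟩, 0) := by
    intro k f t hk h h0 h1
    obtain ⟨e₁, e₂⟩ := hk.straighten_stair h h0 h1
    rw [lower_straighten]
    refine Prod.ext (Complex.ext ?_ ?_) ?_ <;> dsimp only <;> linarith
  have hfar : ∀ {k f t}, Row ty w k f → 8 * w ≤ k → 0 ≤ t → t ≤ f.len →
      lower (straighten (16 * w) (⟨f.x + t * f.dx, f.y + t * f.dy⟩,
        f.x + t * f.dx - (f.y + t * f.dy))) = (⟨f.x + t * f.dx, f.y + t * f.dy⟩, 0) := by
    intro k f t hk h h0 h1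
    have e := hk.straighten_far hw h h0 h1
    rw [lower_straighten, e]
    refine Prod.ext (Complex.ext ?_ ?_) ?_ <;> dsimp only <;> linarith
  ext q
  constructor
  · rintro ⟨q, ⟨i, t, ⟨h0, h1⟩, rfl⟩, rfl⟩
    obtain ⟨k, f, hk, rfl⟩ := exists_eq_cast i
    have hl := hk.len_pos hw
    have t0 : 0 ≤ t * f.len := by positivity
    have t1 : t * f.len ≤ f.len := by nlinarith
    rw [hk.point_eq, hk.height_eq, Homeomorph.trans_apply]
    split_ifs with h
    · have hk' : (k : ℝ) + 1 ≤ 8 * w := by exact_mod_cast h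
      rw [hk.len_stair h] at t0 t1 ⊢
      rw [hstair hk h t0 t1]
      exact ⟨mem_outline_diag hw (by positivity) (by linarith), rfl⟩
    · rw [hfar hk (by omega) t0 t1]
      exact ⟨hk.mem_outline hw (by omega) t0 t1, rfl⟩
  · obtain ⟨z, y⟩ := q
    rintro ⟨h, rfl : y = 0⟩
    rcases exists_of_mem_outline hw h with ⟨t, h0, h1, rfl⟩ | ⟨k, f, t, hk, hk', h0, h1, rfl⟩
    · obtain ⟨k, a, hk, a0, a1, rfl⟩ : ∃ (k : ℕ) (a : ℝ), k < 8 * w ∧ 0 ≤ a ∧ a ≤ 1 ∧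
          t = k + a := by
        -- The end `t = 8w` is treated apart, since its floor is no longer the index of a staircase
        -- edge.
        rcases h1.eq_or_lt with rfl | h
        · refine ⟨8 * w - 1, 1, by omega, zero_le_one, le_rfl, ?_⟩
          rw [Nat.cast_sub (by omega)]
          push_cast
          ring
        · refine ⟨⌊t⌋₊, t - ⌊t⌋₊, ?_, sub_nonneg.2 (Nat.floor_le h0), ?_, by ring⟩
          · rw [Nat.floor_lt h0]; exact_mod_cast h
          · linarith [Nat.lt_floor_add_one t]
      obtain ⟨f, hf⟩ := exists_row ty (w := w) (k := k) (by have := numFolds_bounds ty w; omega)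
      refine ⟨_, ⟨(k : ZMod (ribbon ty w s).n), a, ⟨a0, a1⟩, rfl⟩, ?_⟩
      rw [hf.point_eq, hf.height_eq, Homeomorph.trans_apply, if_pos hk, hf.len_stair hk,
        hstair hf hk (by positivity) (by linarith)]
      simp
    · have hl := hk.len_pos hw
      have e : t / f.len * f.len = t := by field_simp
      refine ⟨_, ⟨(k : ZMod (ribbon ty w s).n), t / f.len,
        ⟨by positivity, (div_le_one hl).2 h1⟩, rfl⟩, ?_⟩
      rw [hk.point_eq, hk.height_eq, Homeomorph.trans_apply, if_neg (by omega), e,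
        hfar hk hk' h0 h1]

theorem ribbon_isUnknot (hw : 0 < w) : (ribbon ty w s).IsUnknot := by
  obtain ⟨φ, hφ⟩ := exists_homeomorph_outline ty hw
  refine ⟨height ty w s, ribbon_isLift hw,
    ((straighten (16 * w)).trans lower).trans (φ.prodCongr (Homeomorph.refl ℝ)), ?_⟩
  have e : ⇑(((straighten (16 * w)).trans lower).trans (φ.prodCongr (Homeomorph.refl ℝ))) =
      Prod.map φ id ∘ ⇑((straighten (16 * w)).trans lower) := rfl
  rw [e, Set.image_comp, image_liftedCurve hw]
  ext ⟨z, y⟩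
  have hz : z ∈ φ '' outline ty w ↔ ‖z‖ = 1 := by rw [hφ]; rfl
  constructor
  · rintro ⟨⟨z', y'⟩, ⟨h, rfl : y' = 0⟩, e⟩
    obtain ⟨rfl, rfl⟩ := Prod.ext_iff.1 e
    exact ⟨hz.1 ⟨z', h, rfl⟩, rfl⟩
  · rintro ⟨h, rfl : y = 0⟩
    obtain ⟨z', h', rfl⟩ := hz.2 h
    exact ⟨(z', 0), ⟨h', rfl⟩, rfl⟩

end

end FoldedRibbon

/-! ### The choice of parameters. -/

theorem mainTheorem2 :
    ∃ (C : ℝ) (c : ℕ), ∀ (N : ℕ) (s : ℤ), (s = 1 ∨ s = -1) →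
      ∀ ty : FoldedRibbon.BandType,
        ∃ R : FoldedRibbon.FoldedRibbonKnot,
          R.bandType = ty ∧
          R.IsUnknot ∧
          R.ribbonlength ≤ C ∧
          R.GeneralPosition ∧
          (N : ℚ) ≤ (s : ℚ) * R.ribbonLk ∧
          R.NoCrossings ∧
          R.ribbonLk = R.foldCount ∧
          ∃ w m : ℕ, 0 < m ∧ w + m ≤ R.n ∧ R.n ≤ w + m + c ∧
            R.DiagonalFolds 0 (w + m) ∧
            R.IsWrapping 0 w s ∧
            R.IsAccordion w m ∧
            ∑ j ∈ Finset.range m, R.foldSign ((w + j : ℕ) : ZMod R.n) = 0 := by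
  refine ⟨30, 3, fun N s hs ty => ?_⟩
  -- The number of wraps must be odd, and the annulus counts only half: `(w + 1) / 2 = N + 2`.
  have hw : 0 < 2 * N + 3 := by omega
  have hodd : (2 * N + 3) % 2 = 1 := by omega
  generalize hN : 2 * N + 3 = w at hw hodd
  have hn := FoldedRibbon.numFolds_bounds ty w
  have hLk := FoldedRibbon.ribbonLk_eq (ty := ty) hw hodd hs
  refine ⟨FoldedRibbon.knot ty w s hw hodd hs, FoldedRibbon.ribbon_bandType,
    FoldedRibbon.ribbon_isUnknot hw, FoldedRibbon.ribbonlength_le hw,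
    FoldedRibbon.ribbon_generalPosition hw hodd, ?_, FoldedRibbon.ribbon_noCrossings hw, hLk,
    w, 7 * w + 1, by omega, ?_, ?_, ?_, FoldedRibbon.ribbon_isWrapping hw hodd hs,
    FoldedRibbon.ribbon_isAccordion hw hodd hs, ?_⟩
  · rw [FoldedRibbon.knot_toRibbonData, hLk, FoldedRibbon.RibbonData.foldCount,
      FoldedRibbon.ribbon_bandType, FoldedRibbon.ribbon_foldSum hw hodd hs]
    have hs' : (s : ℚ) * s = 1 := by rcases hs with rfl | rfl <;> norm_num
    have hw' : (2 * N + 3 : ℚ) = w := by exact_mod_cast hN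
    have hN' : (0 : ℚ) ≤ N := N.cast_nonneg
    cases ty
    · simp only [FoldedRibbon.numFolds]
      push_cast
      rw [← mul_assoc, hs']
      linarith
    · simp only [FoldedRibbon.numFolds]
      push_cast
      rw [← mul_div_assoc, ← mul_assoc, hs']
      linarith
  · change _ ≤ FoldedRibbon.numFolds ty w
    omega
  · change FoldedRibbon.numFolds ty w ≤ _
    omega
  · rw [show w + (7 * w + 1) = 8 * w + 1 by ring]
    exact FoldedRibbon.ribbon_diagonalFolds hw
  · have h := FoldedRibbon.ribbon_sum_accordion (ty := ty) hw hodd hs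
    rw [Finset.sum_Ico_eq_sum_range, show 8 * w + 1 - w = 7 * w + 1 by omega] at h
    exact h
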